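/- Let $f_0,f_1$ be probability densities with respect to a common measure $\mu$, defining distinct probability laws $P_0\neq P_1$. Let $b\in\mathbb R$ and $\pi_0\in[0,1)$ be fixed with $\log\frac{\pi_0}{1-\pi_0}\le b$ (for instance $\pi_0=0$). For $0<\rho<1$ let the change point $\Gamma$ have law $P(\Gamma=0)=\pi_0$, $P(\Gamma=k)=(1-\pi_0)\rho(1-\rho)^{k-1}$ for $k\ge1$, and, given $\Gamma$, let $X_1,X_2,\dots$ be independent, $X_n$ having density $f_0$ if $n<\Gamma$ and $f_1$ if $n\ge\Gamma$. Put $\Phi(p)=p+(1-p)\rho$ and $L=f_1/f_0$. Let $p_0=\pi_0$, $Z_k=\log\frac{p_k}{1-p_k}\in[-\infty,\infty]$, and for $k\ge0$ $$S_{k+1}=\mathbf 1_{\{Z_k\ge b\}},\qquad p_{k+1}=\begin{cases}\Phi(p_k)&\text{if }S_{k+1}=0,\\[2pt] \dfrac{\Phi(p_k)L(X_{k+1})}{\Phi(p_k)L(X_{k+1})+1-\Phi(p_k)}&\text{if }S_{k+1}=1.\end{cases}$$ For $a\in\mathbb R$ let $\tau=\inf\{k\ge1: Z_k>a\}$ and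 $$\mathrm{ANO}=\mathrm{ANO}(a,b,\rho)=\mathrm E\Big[\sum_{k=1}^{\min\{\tau,\Gamma-1\}}S_k\Big].$$ Let $\mathrm P_\infty,\mathrm E_\infty$ refer to $X_1,X_2,\dots$ i.i.d. with density $f_0$. Let $\hat\lambda=\inf\{k\ge1:Z_k<b\}$ for the process $Z_k$ started at $Z_0=b$ with no upper threshold ($a=\infty$), and let $t(x,b)=\inf\{k\ge0: Z_k>b\}$ for the process started at $Z_0=x$ and updated without observations, $p_{k+1}=\Phi(p_k)$. In the denominator below, $\Gamma$ denotes a random variable that is independent of the observations and geometric with parameter $\rho$ on $\{1,2,\dots\}$. Then, for fixed $b$ and $\pi_0$, as $a\to\infty$ and $\rho\to0^+$ (jointly), $$\mathrm{ANO}=\frac{\mathrm E_\infty[\hat\lambda]}{\mathrm P_\infty[\Gamma\le\hat\lambda+t(Z_{\hat\lambda},b)]}\cdot\frac1{1+e^b}\,(1+o(1)).$$ -/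

import Mathlib

open MeasureTheory Filter Topology
open scoped ENNReal NNReal

noncomputable section

namespace QuickestChange

/-- `log (p / (1 - p))`, with value `-∞` at `p = 0` and `+∞` at `p = 1`. -/
def logOdds (p : ℝ) : EReal :=
  ENNReal.log (ENNReal.ofReal p / ENNReal.ofReal (1 - p))

/-- The belief update when no observation is taken. -/
def skipUpdate (ρ p : ℝ) : ℝ := p + (1 - p) * ρ

/-- The belief update when an observation is taken at which the pre-change and post-change
densities have the values `u` and `v`.  It is `q L / (q L + (1 - q))` with `q = skipUpdate ρ p`
and `L = v / u`, written without the division by `u`. -/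
def takeUpdate (ρ : ℝ) (u v : ℝ≥0) (p : ℝ) : ℝ :=
  skipUpdate ρ p * v / (skipUpdate ρ p * v + (1 - skipUpdate ρ p) * u)

/-- The first `k` with `Q k`, and `∞` if there is none. -/
def firstTime (Q : ℕ → Prop) : ℕ∞ := ⨅ (k : ℕ) (_ : Q k), (k : ℕ∞)

section Paths

variable {E : Type*} (f₀ f₁ : E → ℝ≥0) (ρ b π₀ : ℝ)

/-- The belief `p_k` along the observations `x 1, x 2, …` (the value `x 0` is not used), started
at `p_0 = π₀`: the observation `x (k + 1)` is taken exactly when `log (p_k / (1 - p_k)) ≥ b`. -/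
def belief (x : ℕ → E) : ℕ → ℝ
  | 0 => π₀
  | k + 1 =>
    if (b : EReal) ≤ logOdds (belief x k) then
      takeUpdate ρ (f₀ (x (k + 1))) (f₁ (x (k + 1))) (belief x k)
    else skipUpdate ρ (belief x k)

/-- The log-odds statistic `Z_k`. -/
def Z (x : ℕ → E) (k : ℕ) : EReal := logOdds (belief f₀ f₁ ρ b π₀ x k)

/-- The on-off control: `samples … x k` is `S_{k+1}`. -/
def samples (x : ℕ → E) (k : ℕ) : ℕ := if (b : EReal) ≤ Z f₀ f₁ ρ b π₀ x k then 1 else 0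

/-- The stopping time `τ = inf {k ≥ 1 : Z_k > a}`. -/
def stopTime (a : ℝ) (x : ℕ → E) : ℕ∞ :=
  firstTime fun k => 1 ≤ k ∧ (a : EReal) < Z f₀ f₁ ρ b π₀ x k

/-- `∑_{k=1}^{min {τ, γ - 1}} S_k`, where `γ` is the change point. -/
def numObsBefore (a : ℝ) (γ : ℕ) (x : ℕ → E) : ℕ :=
  ∑ k ∈ Finset.range (min (stopTime f₀ f₁ ρ b π₀ a x) ((γ - 1 : ℕ) : ℕ∞)).toNat,
    samples f₀ f₁ ρ b π₀ x k

/-- `B = e^b / (1 + e^b)`, the belief whose log-odds are `b`. -/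
def beliefOf (b : ℝ) : ℝ := Real.exp b / (1 + Real.exp b)

/-- `λ̂`: started at `Z_0 = b` with no upper threshold, the first `k ≥ 1` with `Z_k < b`. -/
def hatLambda (x : ℕ → E) : ℕ∞ :=
  firstTime fun k => 1 ≤ k ∧ Z f₀ f₁ ρ b (beliefOf b) x k < (b : EReal)

/-- `t(x, y)` with `x = log (p / (1 - p))`: the time at which `Z_k`, started at `x` and updated
without observations, first exceeds `y`. -/
def climbTime (ρ p y : ℝ) : ℕ∞ :=
  firstTime fun k => (y : EReal) < logOdds ((skipUpdate ρ)^[k] p)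

/-- `λ̂ + t(Z_λ̂, b)`, which is `∞` if `λ̂` is. -/
def cycleLength (x : ℕ → E) : ℕ∞ :=
  hatLambda f₀ f₁ ρ b x +
    climbTime ρ (belief f₀ f₁ ρ b (beliefOf b) x (hatLambda f₀ f₁ ρ b x).toNat) b

end Paths

section Laws

/-- The probability that the change point equals `k`. -/
def priorWeight (ρ π₀ : ℝ) (k : ℕ) : ℝ :=
  if k = 0 then π₀ else (1 - π₀) * ρ * (1 - ρ) ^ (k - 1)

/-- The law of the change point; for `π₀ = 0` it is geometric on `{1, 2, …}`. -/
def changeLaw (ρ π₀ : ℝ) : Measure ℕ :=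
  Measure.sum fun k => ENNReal.ofReal (priorWeight ρ π₀ k) • Measure.dirac k

variable {E : Type*} [MeasurableSpace E] (P₀ P₁ : Measure E)

/-- The law of the `n`-th observation when the change happens at time `ℓ` (possibly `ℓ = ∞`). -/
def marginal (ℓ : ℕ∞) (n : ℕ) : Measure E := if (n : ℕ∞) < ℓ then P₀ else P₁

instance [IsProbabilityMeasure P₀] [IsProbabilityMeasure P₁] (ℓ : ℕ∞) (n : ℕ) :
    IsProbabilityMeasure (marginal P₀ P₁ ℓ n) := by
  unfold marginal; split <;> infer_instance

variable [IsProbabilityMeasure P₀] [IsProbabilityMeasure P₁]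

/-- `P_ℓ`, the law of the observation sequence when the change happens at time `ℓ`; `P_∞` is the
law of an i.i.d. sequence with law `P₀`. -/
def obsLaw (ℓ : ℕ∞) : Measure (ℕ → E) := Measure.infinitePi (marginal P₀ P₁ ℓ)

/-- The joint law of the change point and the observations: given the change point `ℓ`, the
observations have the law `P_ℓ`. -/
def jointLaw (ρ π₀ : ℝ) : Measure (ℕ × (ℕ → E)) :=
  Measure.sum fun ℓ : ℕ => ENNReal.ofReal (priorWeight ρ π₀ ℓ) •
    (obsLaw P₀ P₁ (ℓ : ℕ∞)).map (Prod.mk ℓ)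

variable (f₀ f₁ : E → ℝ≥0)

/-- The average number of observations used before the change point by the policy `γ(a, b)`. -/
def ANO (a b ρ π₀ : ℝ) : ℝ≥0∞ :=
  ∫⁻ ω, (numObsBefore f₀ f₁ ρ b π₀ a ω.1 ω.2 : ℝ≥0∞) ∂(jointLaw P₀ P₁ ρ π₀)

/-- `E_∞[λ̂]`. -/
def meanHatLambda (b ρ : ℝ) : ℝ≥0∞ :=
  ∫⁻ x, (hatLambda f₀ f₁ ρ b x : ℝ≥0∞) ∂(obsLaw P₀ P₁ ⊤)

/-- `P_∞[Γ ≤ λ̂ + t(Z_λ̂, b)]`, with `Γ` geometric with parameter `ρ` and independent of the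
observations. -/
def probChangeInCycle (b ρ : ℝ) : ℝ≥0∞ :=
  ((changeLaw ρ 0).prod (obsLaw P₀ P₁ ⊤))
    {ω | (ω.1 : ℕ∞) ≤ cycleLength f₀ f₁ ρ b ω.2}

end Laws

end QuickestChange

end

/-! In terms of the odds `r = p / (1 - p)`, a skipped step is `r ↦ (r + ρ) / (1 - ρ)`, and an
observation multiplies the result by `L = f₁ / f₀`. Before the change the observations look i.i.d.
with law `P₀`, and `P(Γ > m) = (1 - π₀)(1 - ρ)^m`. Hence ANO is `(1 - π₀)(1 - ρ)` times the expected
number of observations under `P_∞`, discounted by `1 - ρ` per step and killed when the odds exceed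
`α = e^a` (`ANO_eq`).

The key identity is `(1 - ρ)(1 + skipOdds ρ r) = 1 + r`: multiples of `1 + r` are harmonic for the
discounted climb without observations. So below `β = e^b` the discounted count is about `c (1 + r) /
(1 + β)`, where `c` is its value at `β`. A cycle from `β` contributes `m = E[λ̂]` observations and
then returns to `β` with discount `H = E[(1 + r_λ̂) / (1 + β)]`, both taken at `ρ = 0`. The renewal
equation `c = m + c H` gives `c = m / (1 - H)`. Overshoot at `β`, discounting and stopping at `α`
disappear in the limit. They are controlled by comparison: a cycle with terminal reward using a
slightly larger (smaller) `c` is a super- (sub-) solution of the full problem (`discountedObs_le`,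
`le_discountedObs`, `tendsto_discountedObs`).

The prior factor `1 - π₀ = 1 / (1 + r)` cancels `1 + r`, so ANO tends to `m / ((1 - H)(1 + β))`. On
the other side, `E_∞[λ̂] → m`, and a climb of `N` steps satisfies `(1 - ρ)^N ≈ (1 + r) / (1 + β)`,
so the probability of a change within a cycle tends to `1 - H` (`tendsto_probChangeInCycle`).

The limits are by dominated convergence. Integrability comes from the affinity `∫ √L dP₀ < 1` of
distinct laws, which makes a multiple of `√(r / β)` a supersolution for the sojourn above `β`, for
small `ρ` as well (`meanSojourn_lt_top`). Monotonicity of the paths in `ρ` and in the starting point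
turns one such sojourn into a common bound. -/

noncomputable section

namespace QuickestChange

/-! ### Weighted rewards of a Markov chain: first-step equations and comparison principles. -/

section Chain

variable {E : Type*}

/-- The sequence `x` with `y` inserted as the observation number `1`. -/
def insertObs (y : E) (x : ℕ → E) : ℕ → E
  | 0 => x 0
  | 1 => y
  | n + 2 => x (n + 1)

/-- The chain started at `r` and driven by the observations `x 1, x 2, …`. -/
def chain (g : ℝ≥0 → E → ℝ≥0) (r : ℝ≥0) (x : ℕ → E) : ℕ → ℝ≥0
  | 0 => r
  | k + 1 => g (chain g r x k) (x (k + 1))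

lemma chain_insertObs (g : ℝ≥0 → E → ℝ≥0) (r : ℝ≥0) (y : E) (x : ℕ → E) (k : ℕ) :
    chain g r (insertObs y x) (k + 1) = chain g (g r y) x k := by
  induction k with
  | zero => rfl
  | succ k ih => rw [chain, ih]; rfl

/-- The reward `h` collected at time `k` along the chain, weighted by the factors `w` of the
transitions made before. -/
def pathTerm (g : ℝ≥0 → E → ℝ≥0) (h : ℝ≥0 → ℝ≥0∞) (w : ℝ≥0 → ℝ≥0 → ℝ≥0∞) (r : ℝ≥0)
    (x : ℕ → E) (k : ℕ) : ℝ≥0∞ :=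
  (∏ j ∈ Finset.range k, w (chain g r x j) (chain g r x (j + 1))) * h (chain g r x k)

lemma pathTerm_insertObs (g : ℝ≥0 → E → ℝ≥0) (h : ℝ≥0 → ℝ≥0∞) (w : ℝ≥0 → ℝ≥0 → ℝ≥0∞) (r : ℝ≥0)
    (y : E) (x : ℕ → E) (k : ℕ) :
    pathTerm g h w r (insertObs y x) (k + 1) = w r (g r y) * pathTerm g h w (g r y) x k := by
  simp only [pathTerm, Finset.prod_range_succ', chain_insertObs]
  rw [mul_comm (∏ _ ∈ _, _) (w _ _), mul_assoc]
  rfl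

variable [MeasurableSpace E]

lemma measurable_insertObs : Measurable fun z : E × (ℕ → E) => insertObs z.1 z.2 := by
  refine measurable_pi_lambda _ fun n => ?_
  match n with
  | 0 => exact (measurable_pi_apply 0).comp measurable_snd
  | 1 => exact measurable_fst
  | n + 2 => exact (measurable_pi_apply (n + 1)).comp measurable_snd

/-- An i.i.d. sequence stays i.i.d. when a fresh independent draw is put in and the later entries
are shifted. The draw enters at index `1`, because the chain never reads index `0`. Equality is
tested on finite boxes. -/
lemma map_insertObs (P : Measure E) [IsProbabilityMeasure P] :
    (P.prod (Measure.infinitePi fun _ : ℕ => P)).map (fun z => insertObs z.1 z.2)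
      = Measure.infinitePi fun _ : ℕ => P := by
  refine Measure.eq_infinitePi _ fun s t ht => ?_
  classical
  set t' : ℕ → Set E := fun i => if i ∈ s then t i else Set.univ with ht'
  have mt' : ∀ i, MeasurableSet (t' i) := fun i => by
    simp only [ht']; split_ifs
    exacts [ht i, MeasurableSet.univ]
  -- The box is padded to contain both indices `0` and `1`, so that its preimage is visibly a
  -- product.
  obtain ⟨N, hN⟩ : ∃ N, s ⊆ Finset.range (N + 2) :=
    ⟨s.sup id, fun i hi => Finset.mem_range.2 (by
      have : i ≤ s.sup id := Finset.le_sup (f := id) hi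
      omega)⟩
  have hpi : (s : Set ℕ).pi t = ((Finset.range (N + 2) : Finset ℕ) : Set ℕ).pi t' := by
    ext x
    simp only [Set.mem_pi, Finset.mem_coe, ht']
    constructor
    · intro hx i _
      split_ifs with hi
      exacts [hx i hi, Set.mem_univ _]
    · intro hx i hi
      have := hx i (hN hi)
      rwa [if_pos hi] at this
  have hprod : ∏ i ∈ s, P (t i) = ∏ i ∈ Finset.range (N + 2), P (t' i) := by
    rw [← Finset.prod_subset hN (f := fun i => P (t' i))]
    · exact Finset.prod_congr rfl fun i hi => by simp [ht', hi]
    · intro i _ hi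
      simp [ht', hi]
  rw [hpi, hprod, Measure.map_apply measurable_insertObs
    (MeasurableSet.pi (Finset.countable_toSet _) fun i _ => mt' i)]
  have hpre : (fun z : E × (ℕ → E) => insertObs z.1 z.2) ⁻¹'
      ((Finset.range (N + 2) : Finset ℕ) : Set ℕ).pi t' =
      (t' 1) ×ˢ ((Finset.range (N + 1) : Finset ℕ) : Set ℕ).pi
        (fun i => if i = 0 then t' 0 else t' (i + 1)) := by
    ext ⟨y, x⟩
    simp only [Set.mem_preimage, Set.mem_pi, Finset.coe_range, Set.mem_Iio, Set.mem_prod]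
    constructor
    · intro hx
      refine ⟨hx 1 (by omega), fun i hi => ?_⟩
      rcases i with _ | i
      · exact hx 0 (by omega)
      · exact hx (i + 2) (by omega)
    · rintro ⟨h1, hx⟩ i hi
      match i, hi with
      | 0, _ => exact hx 0 (by omega)
      | 1, _ => exact h1
      | i + 2, hi => exact hx (i + 1) (by omega)
  rw [hpre, Measure.prod_prod, Measure.infinitePi_pi]
  · rw [Finset.prod_range_succ', Finset.prod_range_succ', Finset.prod_range_succ']
    simp only [if_true, Nat.add_eq_zero_iff, one_ne_zero, and_false, if_false, zero_add]
    ring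
  · intro i _
    split_ifs
    exacts [mt' _, mt' _]

lemma lintegral_insertObs (P : Measure E) [IsProbabilityMeasure P] {F : (ℕ → E) → ℝ≥0∞}
    (hF : Measurable F) :
    ∫⁻ x, F x ∂(Measure.infinitePi fun _ : ℕ => P) =
      ∫⁻ y, ∫⁻ x, F (insertObs y x) ∂(Measure.infinitePi fun _ : ℕ => P) ∂P := by
  conv_lhs => rw [← map_insertObs P]
  rw [lintegral_map hF measurable_insertObs]
  exact lintegral_prod _ (hF.comp measurable_insertObs).aemeasurable

variable {g : ℝ≥0 → E → ℝ≥0} {h : ℝ≥0 → ℝ≥0∞} {w : ℝ≥0 → ℝ≥0 → ℝ≥0∞}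

lemma measurable_chain (hg : Measurable g.uncurry) (k : ℕ) :
    Measurable fun z : ℝ≥0 × (ℕ → E) => chain g z.1 z.2 k := by
  induction k with
  | zero => exact measurable_fst
  | succ k ih =>
    exact hg.comp (ih.prodMk ((measurable_pi_apply (k + 1)).comp measurable_snd))

lemma measurable_pathTerm (hg : Measurable g.uncurry) (hh : Measurable h)
    (hw : Measurable w.uncurry) (k : ℕ) :
    Measurable fun z : ℝ≥0 × (ℕ → E) => pathTerm g h w z.1 z.2 k := by
  unfold pathTerm
  refine Measurable.mul (Finset.measurable_prod _ fun j _ => ?_) (hh.comp (measurable_chain hg k))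
  exact hw.comp ((measurable_chain hg j).prodMk (measurable_chain hg (j + 1)))

variable (P : Measure E)

/-- The mean of `pathTerm` for independent observations with law `P`. -/
def meanTerm (g : ℝ≥0 → E → ℝ≥0) (h : ℝ≥0 → ℝ≥0∞) (w : ℝ≥0 → ℝ≥0 → ℝ≥0∞) (k : ℕ) (r : ℝ≥0) :
    ℝ≥0∞ :=
  ∫⁻ x, pathTerm g h w r x k ∂(Measure.infinitePi fun _ : ℕ => P)

/-- The mean total reward of the chain started at `r`. -/
def potential (g : ℝ≥0 → E → ℝ≥0) (h : ℝ≥0 → ℝ≥0∞) (w : ℝ≥0 → ℝ≥0 → ℝ≥0∞) (r : ℝ≥0) : ℝ≥0∞ :=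
  ∑' k, meanTerm P g h w k r

/-- The mean reward collected by the chain at the times before `n`. -/
def partialPotential (g : ℝ≥0 → E → ℝ≥0) (h : ℝ≥0 → ℝ≥0∞) (w : ℝ≥0 → ℝ≥0 → ℝ≥0∞) (n : ℕ)
    (r : ℝ≥0) : ℝ≥0∞ :=
  ∑ k ∈ Finset.range n, meanTerm P g h w k r

lemma potential_eq_iSup (g : ℝ≥0 → E → ℝ≥0) (h : ℝ≥0 → ℝ≥0∞) (w : ℝ≥0 → ℝ≥0 → ℝ≥0∞) (r : ℝ≥0) :
    potential P g h w r = ⨆ n, partialPotential P g h w n r :=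
  ENNReal.tsum_eq_iSup_nat

lemma potential_eq_lintegral (hg : Measurable g.uncurry) (hh : Measurable h)
    (hw : Measurable w.uncurry) (r : ℝ≥0) :
    potential P g h w r =
      ∫⁻ x, ∑' k, pathTerm g h w r x k ∂(Measure.infinitePi fun _ : ℕ => P) := by
  exact (lintegral_tsum fun k => ((measurable_pathTerm hg hh hw k).comp
    (measurable_const.prodMk measurable_id)).aemeasurable).symm

variable [IsProbabilityMeasure P]

lemma measurable_meanTerm (hg : Measurable g.uncurry) (hh : Measurable h)
    (hw : Measurable w.uncurry) (k : ℕ) : Measurable (meanTerm P g h w k) :=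
  Measurable.lintegral_prod_right (measurable_pathTerm hg hh hw k)

lemma meanTerm_zero (g : ℝ≥0 → E → ℝ≥0) (h : ℝ≥0 → ℝ≥0∞) (w : ℝ≥0 → ℝ≥0 → ℝ≥0∞) (r : ℝ≥0) :
    meanTerm P g h w 0 r = h r := by
  simp [meanTerm, pathTerm, chain]

/-- The Markov property: conditioning on the first observation restarts the chain at `g r y`. -/
lemma meanTerm_succ (hg : Measurable g.uncurry) (hh : Measurable h)
    (hw : Measurable w.uncurry) (k : ℕ) (r : ℝ≥0) :
    meanTerm P g h w (k + 1) r = ∫⁻ y, w r (g r y) * meanTerm P g h w k (g r y) ∂P := by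
  have hm : ∀ k r, Measurable fun x : ℕ → E => pathTerm g h w r x k := fun k r =>
    (measurable_pathTerm hg hh hw k).comp (measurable_const.prodMk measurable_id)
  rw [meanTerm, lintegral_insertObs P (hm _ _)]
  refine lintegral_congr fun y => ?_
  simp only [pathTerm_insertObs]
  rw [lintegral_const_mul _ (hm _ _)]
  rfl

lemma measurable_step_mul (hg : Measurable g.uncurry) (hw : Measurable w.uncurry)
    {f : ℝ≥0 → ℝ≥0∞} (hf : Measurable f) (r : ℝ≥0) :
    Measurable fun y => w r (g r y) * f (g r y) := by
  have h1 : Measurable fun y => g r y := hg.comp (measurable_const.prodMk measurable_id)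
  exact (hw.comp (measurable_const.prodMk h1)).mul (hf.comp h1)

lemma potential_eq (hg : Measurable g.uncurry) (hh : Measurable h)
    (hw : Measurable w.uncurry) (r : ℝ≥0) :
    potential P g h w r = h r + ∫⁻ y, w r (g r y) * potential P g h w (g r y) ∂P := by
  rw [potential, tsum_eq_zero_add' ENNReal.summable, meanTerm_zero]
  simp only [meanTerm_succ P hg hh hw, potential, ← ENNReal.tsum_mul_left]
  rw [lintegral_tsum fun k =>
    (measurable_step_mul hg hw (measurable_meanTerm P hg hh hw k) r).aemeasurable]

lemma partialPotential_succ (hg : Measurable g.uncurry) (hh : Measurable h)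
    (hw : Measurable w.uncurry) (n : ℕ) (r : ℝ≥0) :
    partialPotential P g h w (n + 1) r =
      h r + ∫⁻ y, w r (g r y) * partialPotential P g h w n (g r y) ∂P := by
  rw [partialPotential, Finset.sum_range_succ', meanTerm_zero, add_comm]
  simp only [meanTerm_succ P hg hh hw, partialPotential, Finset.mul_sum]
  rw [lintegral_finsetSum _ fun k _ => measurable_step_mul hg hw (measurable_meanTerm P hg hh hw k) r]

/-- A supersolution bounds the potential from above. -/
lemma potential_le_of_supersolution (hg : Measurable g.uncurry) (hh : Measurable h)
    (hw : Measurable w.uncurry) {u : ℝ≥0 → ℝ≥0∞}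
    (hu : ∀ r, h r + ∫⁻ y, w r (g r y) * u (g r y) ∂P ≤ u r) (r : ℝ≥0) :
    potential P g h w r ≤ u r := by
  rw [potential_eq_iSup]
  refine iSup_le fun n => ?_
  induction n generalizing r with
  | zero => simp [partialPotential]
  | succ n ih =>
    rw [partialPotential_succ P hg hh hw]
    refine le_trans ?_ (hu r)
    gcongr
    exact ih _

/-- A bounded subsolution bounds the potential from below. -/
lemma le_potential_of_subsolution (hg : Measurable g.uncurry) (hh : Measurable h)
    (hw : Measurable w.uncurry) {u : ℝ≥0 → ℝ≥0∞} {d K : ℝ≥0} (hd : d < 1)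
    (hwd : ∀ r r', w r r' ≤ d) (huK : ∀ r, u r ≤ K)
    (hu : ∀ r, u r ≤ h r + ∫⁻ y, w r (g r y) * u (g r y) ∂P) (r : ℝ≥0) :
    u r ≤ potential P g h w r := by
  -- Iterating the inequality `n` times leaves a remainder that the discount `d < 1` sends to `0`.
  have key : ∀ n r, u r ≤ partialPotential P g h w n r + (d : ℝ≥0∞) ^ n * K := by
    intro n
    induction n with
    | zero => intro r; simpa [partialPotential] using huK r
    | succ n ih =>
      intro r
      rw [partialPotential_succ P hg hh hw]
      refine (hu r).trans ?_
      rw [add_assoc]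
      gcongr
      have hm := measurable_step_mul (w := w) hg hw
        (f := partialPotential P g h w n)
        (Finset.measurable_sum _ fun k _ => measurable_meanTerm P hg hh hw k) r
      calc ∫⁻ y, w r (g r y) * u (g r y) ∂P
          ≤ ∫⁻ y, (w r (g r y) * partialPotential P g h w n (g r y) + d ^ (n + 1) * K) ∂P := by
            refine lintegral_mono fun y => ?_
            calc w r (g r y) * u (g r y)
                ≤ w r (g r y) * (partialPotential P g h w n (g r y) + d ^ n * K) := by
                  gcongr; exact ih _
              _ ≤ _ := by
                  rw [mul_add, pow_succ', mul_assoc]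
                  gcongr
                  exact hwd _ _
        _ = _ := by rw [lintegral_add_left hm]; simp
  have hlim : Tendsto (fun n => potential P g h w r + (d : ℝ≥0∞) ^ n * K) atTop
      (𝓝 (potential P g h w r + 0 * K)) := by
    refine tendsto_const_nhds.add (ENNReal.Tendsto.mul_const ?_ (Or.inr ENNReal.coe_ne_top))
    exact ENNReal.tendsto_pow_atTop_nhds_zero_of_lt_one (by exact_mod_cast hd)
  rw [zero_mul, add_zero] at hlim
  refine ge_of_tendsto' hlim fun n => (key n r).trans ?_
  gcongr
  exact ENNReal.sum_le_tsum _

end Chain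

/-! ### Odds dynamics, and comparison of the full problem with a single cycle. -/

section Odds

variable {E : Type*} (L : E → ℝ≥0) (ρ β α c : ℝ≥0)

/-- The odds after an update without observation. -/
def skipOdds (r : ℝ≥0) : ℝ≥0 := (r + ρ) / (1 - ρ)

/-- The odds after an update with observation `y`, where `L` is the likelihood ratio. -/
def obsStep (r : ℝ≥0) (y : E) : ℝ≥0 := skipOdds ρ r * L y

/-- The update of the odds that takes an observation exactly when they are at least `β`. -/
def controlledStep (r : ℝ≥0) (y : E) : ℝ≥0 := if β ≤ r then obsStep L ρ r y else skipOdds ρ r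

/-- The reward `1` at odds at least `β`. -/
def obsReward (r : ℝ≥0) : ℝ≥0∞ := if β ≤ r then 1 else 0

/-- The discount `1 - ρ` for transitions to odds at most `α`, and `0` for the others. -/
def stopWeight (_r r' : ℝ≥0) : ℝ≥0∞ := if r' ≤ α then ((1 - ρ : ℝ≥0) : ℝ≥0∞) else 0

/-- The reward `1` at odds at least `β`, and the terminal reward `c (1 + r) / (1 + β)` below. -/
def cycleReward (r : ℝ≥0) : ℝ≥0∞ :=
  if β ≤ r then 1 else ((c * ((1 + r) / (1 + β)) : ℝ≥0) : ℝ≥0∞)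

/-- The discount `1 - ρ` for transitions from odds at least `β` to odds at most `α`. -/
def cycleWeight (r r' : ℝ≥0) : ℝ≥0∞ :=
  if β ≤ r ∧ r' ≤ α then ((1 - ρ : ℝ≥0) : ℝ≥0∞) else 0

/-- The weight `1` for transitions from odds at least `β`. -/
def sojournWeight (r _r' : ℝ≥0) : ℝ≥0∞ := if β ≤ r then 1 else 0

variable {ρ}

/-- The discount exactly offsets the growth of `1 + r` in a skipped step; every appearance of `(1 +
r) / (1 + β)` stems from this. -/
lemma one_sub_mul_one_add_skipOdds (hρ : ρ < 1) (r : ℝ≥0) :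
    (1 - ρ) * (1 + skipOdds ρ r) = 1 + r := by
  have h : (1 - ρ : ℝ≥0) ≠ 0 := (tsub_pos_of_lt hρ).ne'
  rw [skipOdds, mul_add, mul_div_cancel₀ _ h, mul_one, add_comm r, ← add_assoc,
    tsub_add_cancel_of_le hρ.le]

lemma skipOdds_mono {ρ ρ' r r' : ℝ≥0} (hρ' : ρ' < 1) (h : ρ ≤ ρ') (hr : r ≤ r') :
    skipOdds ρ r ≤ skipOdds ρ' r' := by
  have : 0 < 1 - ρ' := tsub_pos_of_lt hρ'
  unfold skipOdds
  gcongr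

/-- Above `β` the drift of the odds is at most multiplication by a constant close to `1`, so the
observed odds are dominated by a multiplicative random walk. -/
lemma skipOdds_le_mul {β r : ℝ≥0} (hβ : 0 < β) (hr : β ≤ r) :
    skipOdds ρ r ≤ (1 + ρ / β) / (1 - ρ) * r := by
  rw [skipOdds, div_mul_eq_mul_div]
  gcongr
  rw [add_mul, one_mul]
  gcongr
  calc ρ = ρ / β * β := by field_simp
    _ ≤ _ := by gcongr

variable [MeasurableSpace E]

lemma measurable_skipOdds : Measurable (skipOdds ρ) := by unfold skipOdds; fun_prop

variable {L}

lemma measurable_obsStep (hL : Measurable L) : Measurable (obsStep L ρ).uncurry :=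
  (measurable_skipOdds.comp measurable_fst).mul (hL.comp measurable_snd)

lemma measurable_controlledStep (hL : Measurable L) :
    Measurable (controlledStep L ρ β).uncurry :=
  Measurable.ite (measurableSet_le measurable_const measurable_fst) (measurable_obsStep hL)
    (measurable_skipOdds.comp measurable_fst)

lemma measurable_obsReward : Measurable (obsReward β) :=
  Measurable.ite (measurableSet_le measurable_const measurable_id) measurable_const measurable_const

lemma measurable_stopWeight : Measurable (stopWeight ρ α).uncurry :=
  Measurable.ite (measurable_snd measurableSet_Iic) measurable_const measurable_const

lemma measurable_cycleReward : Measurable (cycleReward β c) :=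
  Measurable.ite (measurableSet_le measurable_const measurable_id) measurable_const
    (by fun_prop)

lemma measurable_cycleWeight : Measurable (cycleWeight ρ β α).uncurry :=
  Measurable.ite ((measurableSet_le measurable_const measurable_fst).inter
    (measurable_snd measurableSet_Iic)) measurable_const measurable_const

lemma measurable_sojournWeight : Measurable (sojournWeight β).uncurry :=
  Measurable.ite (measurableSet_le measurable_const measurable_fst) measurable_const
    measurable_const

variable (P : Measure E) (L ρ)

/-- The mean discounted number of observations before the odds exceed `α`. -/
def discountedObs (r : ℝ≥0) : ℝ≥0∞ :=
  potential P (controlledStep L ρ β) (obsReward β) (stopWeight ρ α) r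

/-- The mean discounted reward of one cycle, with terminal reward. -/
def cyclePotential (r : ℝ≥0) : ℝ≥0∞ :=
  potential P (obsStep L ρ) (cycleReward β c) (cycleWeight ρ β α) r

/-- The mean time spent at odds at least `β` before the first visit below `β`. -/
def meanSojourn (r : ℝ≥0) : ℝ≥0∞ :=
  potential P (obsStep L ρ) (obsReward β) (sojournWeight β) r

variable [IsProbabilityMeasure P] {L ρ β α c}

lemma cyclePotential_of_lt (hL : Measurable L) {r : ℝ≥0} (hr : r < β) :
    cyclePotential L ρ β α c P r = ((c * ((1 + r) / (1 + β)) : ℝ≥0) : ℝ≥0∞) := by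
  rw [cyclePotential, potential_eq P (measurable_obsStep hL) (measurable_cycleReward β c)
    (measurable_cycleWeight β α)]
  simp [cycleReward, cycleWeight, hr.not_ge]

lemma cyclePotential_of_le (hL : Measurable L) {r : ℝ≥0} (hr : β ≤ r) :
    cyclePotential L ρ β α c P r = 1 + ∫⁻ y, stopWeight ρ α r (obsStep L ρ r y) *
      cyclePotential L ρ β α c P (obsStep L ρ r y) ∂P := by
  conv_lhs => rw [cyclePotential, potential_eq P (measurable_obsStep hL)
    (measurable_cycleReward β c) (measurable_cycleWeight β α)]
  simp [cycleReward, cycleWeight, hr, stopWeight, cyclePotential]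

/-- The cycle potential is a supersolution of the full problem. At or above `β` both satisfy the
same one-step equation; below `β` the harmonic terminal reward does, except at the step back to `β`
or higher, where `hc` is used. -/
lemma discountedObs_le (hL : Measurable L) (hρ : ρ < 1)
    (hc : ∀ r, β ≤ r → r ≤ skipOdds ρ β → cyclePotential L ρ β α c P r ≤ c) (r : ℝ≥0) :
    discountedObs L ρ β α P r ≤ cyclePotential L ρ β α c P r := by
  refine potential_le_of_supersolution P (measurable_controlledStep β hL)
    (measurable_obsReward β) (measurable_stopWeight α) (fun r => ?_) r
  rcases le_or_gt β r with hr | hr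
  · rw [cyclePotential_of_le P hL hr]
    simp [controlledStep, hr, obsReward]
  · rw [cyclePotential_of_lt P hL hr]
    simp only [controlledStep, hr.not_ge, obsReward, if_false, zero_add, lintegral_const,
      measure_univ, mul_one]
    calc _ ≤ ((1 - ρ : ℝ≥0) : ℝ≥0∞) * cyclePotential L ρ β α c P (skipOdds ρ r) := by
          gcongr
          unfold stopWeight
          split_ifs <;> simp
      _ ≤ _ := by
        have h1 := one_sub_mul_one_add_skipOdds hρ r
        rcases le_or_gt β (skipOdds ρ r) with h | h
        -- Re-entry: `1 + r = (1 - ρ)(1 + skipOdds ρ r) ≥ (1 - ρ)(1 + β)`, so the overshoot has the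
        -- favourable sign.
        · calc _ ≤ ((1 - ρ : ℝ≥0) : ℝ≥0∞) * c := by
                gcongr; exact hc _ h (skipOdds_mono hρ le_rfl hr.le)
            _ ≤ _ := by
                norm_cast
                rw [← h1, mul_comm]
                gcongr
                rw [le_div_iff₀ (by positivity)]
                gcongr
        · rw [cyclePotential_of_lt P hL h]
          norm_cast
          rw [← h1, mul_left_comm, mul_div_assoc]

/-- At most one unit is earned per step before the terminal reward, and `∑ (1 - ρ)^k = ρ⁻¹`. The
bound serves only as the boundedness required of a subsolution. -/
lemma cyclePotential_le (hL : Measurable L) (hρ : ρ < 1) (hρ0 : 0 < ρ) (r : ℝ≥0) :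
    cyclePotential L ρ β α c P r ≤ ((ρ⁻¹ + c : ℝ≥0) : ℝ≥0∞) := by
  refine potential_le_of_supersolution P (measurable_obsStep hL) (measurable_cycleReward β c)
    (measurable_cycleWeight β α) (u := fun _ => ((ρ⁻¹ + c : ℝ≥0) : ℝ≥0∞)) (fun r => ?_) r
  rcases le_or_gt β r with hr | hr
  · calc _ ≤ 1 + ∫⁻ _, ((1 - ρ : ℝ≥0) : ℝ≥0∞) * ((ρ⁻¹ + c : ℝ≥0) : ℝ≥0∞) ∂P := by
          gcongr
          · simp [cycleReward, hr]
          · unfold cycleWeight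
            split_ifs <;> simp
      _ ≤ _ := by
          simp only [lintegral_const, measure_univ, mul_one]
          norm_cast
          rw [mul_add, tsub_mul, one_mul, mul_inv_cancel₀ hρ0.ne', ← add_assoc,
            add_tsub_cancel_of_le ((one_le_inv₀ hρ0).2 hρ.le)]
          gcongr
          exact mul_le_of_le_one_left zero_le tsub_le_self
  · simp only [cycleReward, hr.not_ge, cycleWeight, if_false, false_and, zero_mul, lintegral_zero,
      add_zero]
    norm_cast
    refine le_add_left (mul_le_of_le_one_right zero_le ?_)
    exact div_le_one_of_le₀ (by gcongr) zero_le

/-- The reverse comparison. Now `hc` must absorb the discount of the re-entry step, and `hα` ensures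
that a climb from below `β` is never stopped. -/
lemma le_discountedObs (hL : Measurable L) (hρ : ρ < 1) (hρ0 : 0 < ρ) (hα : skipOdds ρ β ≤ α)
    (hc : ∀ r, β ≤ r → r ≤ skipOdds ρ β →
      (c : ℝ≥0∞) ≤ ((1 - ρ : ℝ≥0) : ℝ≥0∞) * cyclePotential L ρ β α c P r) (r : ℝ≥0) :
    cyclePotential L ρ β α c P r ≤ discountedObs L ρ β α P r := by
  refine le_potential_of_subsolution P (measurable_controlledStep β hL)
    (measurable_obsReward β) (measurable_stopWeight α) (d := 1 - ρ)
    (tsub_lt_self one_pos hρ0) (fun r r' => ?_)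
    (cyclePotential_le P hL hρ hρ0) (fun r => ?_) r
  · unfold stopWeight; split_ifs <;> simp
  rcases le_or_gt β r with hr | hr
  · rw [cyclePotential_of_le P hL hr]
    simp [controlledStep, hr, obsReward]
  · have hskip := skipOdds_mono hρ le_rfl hr.le
    rw [cyclePotential_of_lt P hL hr]
    simp only [controlledStep, hr.not_ge, obsReward, if_false, zero_add, lintegral_const,
      measure_univ, mul_one, stopWeight, hskip.trans hα, if_true]
    have h1 := one_sub_mul_one_add_skipOdds hρ r
    rcases le_or_gt β (skipOdds ρ r) with h | h
    · refine le_trans ?_ (hc _ h hskip)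
      norm_cast
      refine mul_le_of_le_one_right zero_le ?_
      exact div_le_one_of_le₀ (by gcongr) zero_le
    · rw [cyclePotential_of_lt P hL h]
      norm_cast
      rw [← h1, mul_left_comm, mul_div_assoc]

/-- The function `√(r / β) K` is a supersolution: one observed step multiplies its mean by at most
`s e < 1`, and `K` solves `1 + K s e = K`. The square root supplies the contraction, since the mean
of `L` itself may equal `1`. -/
lemma meanSojourn_lt_top (hL : Measurable L) (hβ : 0 < β) {e : ℝ≥0}
    (he : ∫⁻ y, (NNReal.sqrt (L y) : ℝ≥0∞) ∂P = e)
    (hlt : NNReal.sqrt ((1 + ρ / β) / (1 - ρ)) * e < 1) (r : ℝ≥0) :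
    meanSojourn L ρ β P r < ∞ := by
  set s := NNReal.sqrt ((1 + ρ / β) / (1 - ρ)) with hs
  set K : ℝ≥0 := (1 - s * e)⁻¹ with hK
  have hne : (1 - s * e : ℝ≥0) ≠ 0 := (tsub_pos_of_lt hlt).ne'
  have hKeq : 1 + K * (s * e) = K := by
    have h2 : K * (1 - s * e) = 1 := inv_mul_cancel₀ hne
    calc 1 + K * (s * e) = K * ((1 - s * e) + s * e) := by rw [mul_add, h2]
      _ = K := by rw [tsub_add_cancel_of_le hlt.le, mul_one]
  refine lt_of_le_of_lt (potential_le_of_supersolution P (measurable_obsStep hL)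
    (measurable_obsReward β) (measurable_sojournWeight β)
    (u := fun r => ((NNReal.sqrt (r / β) * K : ℝ≥0) : ℝ≥0∞)) (fun r => ?_) r) ENNReal.coe_lt_top
  rcases le_or_gt β r with hr | hr
  · have hroot : 1 ≤ NNReal.sqrt (r / β) := by
      rw [NNReal.one_le_sqrt]; exact (one_le_div hβ).2 hr
    calc _ ≤ 1 + ∫⁻ y, ((NNReal.sqrt (r / β) * K * s : ℝ≥0) : ℝ≥0∞) * NNReal.sqrt (L y) ∂P := by
          refine add_le_add ?_ (lintegral_mono fun y => ?_)
          · simp [obsReward, hr]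
          · simp only [sojournWeight, hr, if_true, one_mul, obsStep]
            norm_cast
            calc _ ≤ NNReal.sqrt ((1 + ρ / β) / (1 - ρ) * r * L y / β) * K := by
                  gcongr
                  exact skipOdds_le_mul hβ hr
              _ = _ := by
                  rw [show (1 + ρ / β) / (1 - ρ) * r * L y / β =
                    (1 + ρ / β) / (1 - ρ) * (r / β) * L y by
                      rw [mul_div_right_comm, mul_div_assoc], NNReal.sqrt_mul, NNReal.sqrt_mul]
                  rw [← hs]; ring
      _ = ((1 + NNReal.sqrt (r / β) * (K * (s * e)) : ℝ≥0) : ℝ≥0∞) := by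
          rw [lintegral_const_mul _ (by fun_prop), he]
          push_cast
          ring
      _ ≤ _ := by
          norm_cast
          calc 1 + NNReal.sqrt (r / β) * (K * (s * e))
              ≤ NNReal.sqrt (r / β) * 1 + NNReal.sqrt (r / β) * (K * (s * e)) := by
                gcongr; simpa using hroot
            _ = _ := by rw [← mul_add, hKeq]
  · simp [obsReward, sojournWeight, hr.not_ge]

end Odds

/-! ### The first drop below `β`: pathwise values, and limits as `ρ → 0`. -/

section FirstDrop

variable {E : Type*} {L : E → ℝ≥0} {ρ β α c : ℝ≥0}

lemma chain_obsStep_mono {ρ' : ℝ≥0} (hρ' : ρ' < 1) (h : ρ ≤ ρ') {r r' : ℝ≥0} (hr : r ≤ r')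
    (x : ℕ → E) (k : ℕ) : chain (obsStep L ρ) r x k ≤ chain (obsStep L ρ') r' x k := by
  induction k with
  | zero => exact hr
  | succ k ih => exact mul_le_mul_left (skipOdds_mono hρ' h ih) _

lemma continuousAt_chain_obsStep (x : ℕ → E) (k : ℕ) :
    ContinuousAt (fun z : ℝ≥0 × ℝ≥0 => chain (obsStep L z.1) z.2 x k) (0, β) := by
  induction k with
  | zero => exact continuousAt_snd
  | succ k ih =>
    refine ContinuousAt.mul (ContinuousAt.div (ih.add continuousAt_fst) ?_ (by simp))
      continuousAt_const
    exact (continuous_const.sub continuous_fst).continuousAt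

/-- `r k < β` happens for the first time at `k = n`. -/
def FirstBelow (β : ℝ≥0) (r : ℕ → ℝ≥0) (n : ℕ) : Prop := (∀ j < n, β ≤ r j) ∧ r n < β

lemma exists_firstBelow {r : ℕ → ℝ≥0} (h : ∃ n, r n < β) : ∃ n, FirstBelow β r n := by
  classical
  exact ⟨Nat.find h, fun j hj => not_lt.1 (Nat.find_min h hj), Nat.find_spec h⟩

/-- The drop time is stable under perturbations from above, even if the limiting path touches `β`:
raising `ρ` or the start only raises the path, which keeps it at or above `β` before time `n`, while
the strict inequality at time `n` persists by continuity. -/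
lemma eventually_firstBelow {x : ℕ → E} {n : ℕ}
    (h : FirstBelow β (chain (obsStep L 0) β x) n) :
    ∀ᶠ z : ℝ≥0 × ℝ≥0 in 𝓝 0 ×ˢ 𝓝[≥] β, FirstBelow β (chain (obsStep L z.1) z.2 x) n := by
  have hle : 𝓝 (0 : ℝ≥0) ×ˢ 𝓝[≥] β ≤ 𝓝 (0, β) := by
    rw [nhds_prod_eq]; exact prod_mono le_rfl nhdsWithin_le_nhds
  have h1 : ∀ᶠ z : ℝ≥0 × ℝ≥0 in 𝓝 0 ×ˢ 𝓝[≥] β, β ≤ z.2 :=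
    (eventually_mem_nhdsWithin (a := β) (s := Set.Ici β)).prod_inr _
  have h2 : ∀ᶠ z : ℝ≥0 × ℝ≥0 in 𝓝 0 ×ˢ 𝓝[≥] β, z.1 < 1 :=
    (gt_mem_nhds (zero_lt_one' ℝ≥0)).prod_inl _
  have h3 := (((continuousAt_chain_obsStep x n).tendsto.mono_left hle).eventually
    (gt_mem_nhds h.2))
  filter_upwards [h1, h2, h3] with z hz1 hz2 hz3
  exact ⟨fun j hj => (h.1 j hj).trans (chain_obsStep_mono hz2 zero_le hz1 x j), hz3⟩

/-- The reward `(1 + r) / (1 + β)` at odds below `β`. -/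
def exitReward (β r : ℝ≥0) : ℝ≥0∞ := if β ≤ r then 0 else (((1 + r) / (1 + β) : ℝ≥0) : ℝ≥0∞)

lemma exitReward_le_one (β r : ℝ≥0) : exitReward β r ≤ 1 := by
  unfold exitReward
  split_ifs with h
  · simp
  · norm_cast
    exact div_le_one_of_le₀ (by gcongr; exact (not_le.1 h).le) zero_le

lemma measurable_exitReward : Measurable (exitReward β) :=
  Measurable.ite (measurableSet_le measurable_const measurable_id) measurable_const
    (by fun_prop)

section PathTerm

variable {g : ℝ≥0 → E → ℝ≥0} {h : ℝ≥0 → ℝ≥0∞} {w : ℝ≥0 → ℝ≥0 → ℝ≥0∞} {r : ℝ≥0} {x : ℕ → E} {n : ℕ}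

lemma tsum_pathTerm_eq_sum (hw : ∀ r', w (chain g r x n) r' = 0) :
    ∑' k, pathTerm g h w r x k = ∑ k ∈ Finset.range (n + 1), pathTerm g h w r x k := by
  refine tsum_eq_sum fun k hk => ?_
  rw [pathTerm, Finset.prod_eq_zero (i := n) _ (hw _), zero_mul]
  simp only [Finset.mem_range, not_lt] at hk ⊢
  exact hk

lemma tsum_pathTerm_sojourn (hn : FirstBelow β (chain g r x) n) :
    ∑' k, pathTerm g (obsReward β) (sojournWeight β) r x k = n := by
  rw [tsum_pathTerm_eq_sum (n := n) fun r' => by simp [sojournWeight, hn.2.not_ge],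
    Finset.sum_range_succ]
  have h1 : ∀ k ∈ Finset.range n, pathTerm g (obsReward β) (sojournWeight β) r x k = 1 := by
    intro k hk
    rw [Finset.mem_range] at hk
    rw [pathTerm, Finset.prod_eq_one, one_mul, obsReward, if_pos (hn.1 k hk)]
    intro j hj
    rw [sojournWeight, if_pos (hn.1 j ((Finset.mem_range.1 hj).trans hk))]
  rw [Finset.sum_congr rfl h1]
  simp [pathTerm, obsReward, hn.2.not_ge]

lemma tsum_pathTerm_sojourn_eq_top (hn : ∀ k, β ≤ chain g r x k) :
    ∑' k, pathTerm g (obsReward β) (sojournWeight β) r x k = ∞ := by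
  simp only [pathTerm, obsReward, sojournWeight, hn, if_true, Finset.prod_const_one, one_mul]
  exact ENNReal.tsum_const_eq_top_of_ne_zero one_ne_zero

lemma tsum_pathTerm_exit (hn : FirstBelow β (chain g r x) n) :
    ∑' k, pathTerm g (exitReward β) (sojournWeight β) r x k = exitReward β (chain g r x n) := by
  rw [tsum_pathTerm_eq_sum (n := n) fun r' => by simp [sojournWeight, hn.2.not_ge],
    Finset.sum_range_succ]
  have h1 : ∀ k ∈ Finset.range n, pathTerm g (exitReward β) (sojournWeight β) r x k = 0 := by
    intro k hk
    rw [Finset.mem_range] at hk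
    rw [pathTerm, exitReward, if_pos (hn.1 k hk), mul_zero]
  rw [Finset.sum_congr rfl h1, Finset.sum_const_zero, zero_add, pathTerm, Finset.prod_eq_one,
    one_mul]
  intro j hj
  rw [sojournWeight, if_pos (hn.1 j (Finset.mem_range.1 hj))]

lemma tsum_pathTerm_cycle (hn : FirstBelow β (chain g r x) n)
    (hα : ∀ j < n, chain g r x (j + 1) ≤ α) :
    ∑' k, pathTerm g (cycleReward β c) (cycleWeight ρ β α) r x k =
      ∑ k ∈ Finset.range n, ((1 - ρ : ℝ≥0) : ℝ≥0∞) ^ k +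
        ((1 - ρ : ℝ≥0) : ℝ≥0∞) ^ n * (c * exitReward β (chain g r x n)) := by
  have hprod : ∀ k ≤ n, ∏ j ∈ Finset.range k, cycleWeight ρ β α (chain g r x j)
      (chain g r x (j + 1)) = ((1 - ρ : ℝ≥0) : ℝ≥0∞) ^ k := by
    intro k hk
    rw [Finset.prod_congr rfl (g := fun _ => ((1 - ρ : ℝ≥0) : ℝ≥0∞)), Finset.prod_const,
      Finset.card_range]
    intro j hj
    have hj' := (Finset.mem_range.1 hj).trans_le hk
    rw [cycleWeight, if_pos ⟨hn.1 j hj', hα j hj'⟩]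
  rw [tsum_pathTerm_eq_sum (n := n) fun r' => by simp [cycleWeight, hn.2.not_ge],
    Finset.sum_range_succ]
  congr 1
  · refine Finset.sum_congr rfl fun k hk => ?_
    rw [Finset.mem_range] at hk
    rw [pathTerm, hprod k hk.le, cycleReward, if_pos (hn.1 k hk), mul_one]
  · rw [pathTerm, hprod n le_rfl, cycleReward, exitReward, if_neg hn.2.not_ge,
      if_neg hn.2.not_ge, ENNReal.coe_mul]

lemma tsum_pathTerm_cycle_le (hn : FirstBelow β (chain g r x) n) :
    ∑' k, pathTerm g (cycleReward β c) (cycleWeight ρ β α) r x k ≤ n + c := by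
  have hprod : ∀ k, ∏ j ∈ Finset.range k, cycleWeight ρ β α (chain g r x j)
      (chain g r x (j + 1)) ≤ 1 := by
    refine fun k => Finset.prod_le_one' fun j _ => ?_
    unfold cycleWeight
    split_ifs
    · exact_mod_cast tsub_le_self
    · exact zero_le
  rw [tsum_pathTerm_eq_sum (n := n) fun r' => by simp [cycleWeight, hn.2.not_ge],
    Finset.sum_range_succ]
  refine add_le_add ?_ ?_
  · calc _ ≤ ∑ k ∈ Finset.range n, (1 : ℝ≥0∞) := by
          refine Finset.sum_le_sum fun k hk => ?_
          rw [pathTerm, cycleReward, if_pos (hn.1 k (Finset.mem_range.1 hk)), mul_one]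
          exact hprod k
      _ = n := by simp
  · rw [pathTerm]
    refine (mul_le_of_le_one_left zero_le (hprod n)).trans ?_
    rw [cycleReward, if_neg hn.2.not_ge]
    norm_cast
    exact mul_le_of_le_one_right zero_le
      (div_le_one_of_le₀ (by gcongr; exact hn.2.le) zero_le)

end PathTerm

lemma tendsto_coe_one_sub :
    Tendsto (fun ρ : ℝ≥0 => ((1 - ρ : ℝ≥0) : ℝ≥0∞)) (𝓝 0) (𝓝 1) := by
  have : Tendsto (fun ρ : ℝ≥0 => 1 - ρ) (𝓝 0) (𝓝 (1 - 0)) :=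
    (continuous_const.sub continuous_id).tendsto 0
  rw [tsub_zero] at this
  exact ENNReal.tendsto_coe.2 this

lemma tendsto_tsum_pathTerm_cycle {ι : Type*} {l : Filter ι} {α ρ r : ι → ℝ≥0}
    (hα : Tendsto α l atTop) (hρ : Tendsto ρ l (𝓝 0)) (hr : Tendsto r l (𝓝[≥] β))
    (c : ℝ≥0) {x : ℕ → E} {n : ℕ} (hn : FirstBelow β (chain (obsStep L 0) β x) n) :
    Tendsto (fun i => ∑' k,
        pathTerm (obsStep L (ρ i)) (cycleReward β c) (cycleWeight (ρ i) β (α i)) (r i) x k)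
      l (𝓝 (n + c * exitReward β (chain (obsStep L 0) β x n))) := by
  have hpair : Tendsto (fun i => (ρ i, r i)) l (𝓝 0 ×ˢ 𝓝[≥] β) := hρ.prodMk hr
  have hconv : ∀ k, Tendsto (fun i => chain (obsStep L (ρ i)) (r i) x k) l
      (𝓝 (chain (obsStep L 0) β x k)) := by
    intro k
    have h0 := (continuousAt_chain_obsStep (L := L) (β := β) x k).tendsto.comp
      (hρ.prodMk_nhds (hr.mono_right nhdsWithin_le_nhds))
    simpa only [Function.comp_def] using h0
  have hbound : ∀ᶠ i in l, ∀ j ∈ Finset.range n,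
      chain (obsStep L (ρ i)) (r i) x (j + 1) ≤ α i := by
    refine (Filter.eventually_all_finset _).2 fun j _ => ?_
    filter_upwards [hα.eventually_ge_atTop (chain (obsStep L 0) β x (j + 1) + 1),
      (hconv (j + 1)).eventually (ge_mem_nhds (lt_add_one _))] with i hi1 hi2
    exact hi2.trans hi1
  have hd : Tendsto (fun i => ((1 - ρ i : ℝ≥0) : ℝ≥0∞)) l (𝓝 1) := by
    have h0 := tendsto_coe_one_sub.comp hρ
    exact h0
  have hpow : ∀ k : ℕ, Tendsto (fun i => ((1 - ρ i : ℝ≥0) : ℝ≥0∞) ^ k) l (𝓝 1) := fun k => by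
    simpa using ENNReal.Tendsto.pow (n := k) hd
  have hexit : Tendsto (fun i =>
      (((1 + chain (obsStep L (ρ i)) (r i) x n) / (1 + β) : ℝ≥0) : ℝ≥0∞)) l
      (𝓝 (exitReward β (chain (obsStep L 0) β x n))) := by
    rw [exitReward, if_neg hn.2.not_ge]
    exact ENNReal.tendsto_coe.2 (((hconv n).const_add 1).div_const _)
  have hmain : Tendsto (fun i =>
      ∑ k ∈ Finset.range n, ((1 - ρ i : ℝ≥0) : ℝ≥0∞) ^ k + ((1 - ρ i : ℝ≥0) : ℝ≥0∞) ^ n *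
        (c * (((1 + chain (obsStep L (ρ i)) (r i) x n) / (1 + β) : ℝ≥0) : ℝ≥0∞))) l
      (𝓝 (∑ k ∈ Finset.range n, 1 + 1 * (c * exitReward β (chain (obsStep L 0) β x n)))) := by
    refine (tendsto_finsetSum _ fun k _ => hpow k).add
      (ENNReal.Tendsto.mul (hpow n) (Or.inl one_ne_zero) ?_ (Or.inr ENNReal.one_ne_top))
    exact ENNReal.Tendsto.const_mul hexit (Or.inr ENNReal.coe_ne_top)
  simp only [Finset.sum_const, Finset.card_range, nsmul_eq_mul, mul_one, one_mul] at hmain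
  refine hmain.congr' ?_
  filter_upwards [hbound, hpair.eventually (eventually_firstBelow hn)] with i hi1 hi2
  rw [tsum_pathTerm_cycle hi2 fun j hj => hi1 j (Finset.mem_range.2 hj), exitReward,
    if_neg hi2.2.not_ge]

variable [MeasurableSpace E] (P : Measure E)

/-- A path that never drops has infinite sojourn. -/
lemma ae_exists_firstBelow (hL : Measurable L) {r : ℝ≥0} (h : meanSojourn L ρ β P r < ∞) :
    ∀ᵐ x ∂(Measure.infinitePi fun _ : ℕ => P), ∃ n, FirstBelow β (chain (obsStep L ρ) r x) n := by
  rw [meanSojourn, potential_eq_lintegral P (measurable_obsStep hL) (measurable_obsReward β)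
    (measurable_sojournWeight β)] at h
  have hm : Measurable fun x => ∑' k, pathTerm (obsStep L ρ) (obsReward β) (sojournWeight β) r x k :=
    Measurable.tsum fun k => (measurable_pathTerm (measurable_obsStep hL)
      (measurable_obsReward β) (measurable_sojournWeight β) k).comp
      (measurable_const.prodMk measurable_id)
  filter_upwards [ae_lt_top hm h.ne] with x hx
  refine exists_firstBelow ?_
  by_contra! hcon
  exact hx.ne (tsum_pathTerm_sojourn_eq_top hcon)

variable [IsProbabilityMeasure P]

/-- The mean of `exitReward` at the first visit below `β`, started at `r`. -/
def meanExit (L : E → ℝ≥0) (ρ β : ℝ≥0) (r : ℝ≥0) : ℝ≥0∞ :=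
  potential P (obsStep L ρ) (exitReward β) (sojournWeight β) r

lemma exists_pos_sqrt_mul_lt_one {e : ℝ≥0} (he : e < 1) (β : ℝ≥0) :
    ∃ ρ : ℝ≥0, 0 < ρ ∧ ρ < 1 ∧ NNReal.sqrt ((1 + ρ / β) / (1 - ρ)) * e < 1 := by
  have hc : ContinuousAt (fun ρ : ℝ≥0 => NNReal.sqrt ((1 + ρ / β) / (1 - ρ)) * e) 0 := by
    refine ContinuousAt.mul (NNReal.continuous_sqrt.continuousAt.comp
      (ContinuousAt.div ?_ ?_ (by simp))) continuousAt_const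
    · simp only [div_eq_mul_inv]; fun_prop
    · exact (continuous_const.sub continuous_id).continuousAt
  have h1 : ∀ᶠ ρ : ℝ≥0 in 𝓝[>] 0, NNReal.sqrt ((1 + ρ / β) / (1 - ρ)) * e < 1 :=
    (hc.tendsto.mono_left nhdsWithin_le_nhds).eventually (gt_mem_nhds (by simpa using he))
  have h2 : ∀ᶠ ρ : ℝ≥0 in 𝓝[>] 0, ρ < 1 := nhdsWithin_le_nhds (gt_mem_nhds one_pos)
  obtain ⟨ρ, hρ1, hρ2, hρ3⟩ := (h1.and (h2.and self_mem_nhdsWithin)).exists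
  exact ⟨ρ, hρ3, hρ2, hρ1⟩

/-- The limit is joint in `α`, `ρ` and the starting point `r ↓ β`, because re-entry overshoots `β`
by an amount depending on `ρ`. -/
lemma tendsto_cyclePotential (hL : Measurable L) (hβ : 0 < β) {e : ℝ≥0}
    (he : ∫⁻ y, (NNReal.sqrt (L y) : ℝ≥0∞) ∂P = e) (hlt : e < 1) (c : ℝ≥0) :
    Tendsto (fun z : (ℝ≥0 × ℝ≥0) × ℝ≥0 => cyclePotential L z.1.2 β z.1.1 c P z.2)
      ((atTop ×ˢ 𝓝 0) ×ˢ 𝓝[≥] β) (𝓝 (meanSojourn L 0 β P β + c * meanExit P L 0 β β)) := by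
  obtain ⟨ρ₁, hρ₁0, hρ₁1, hρ₁⟩ := exists_pos_sqrt_mul_lt_one hlt β
  have hfin := meanSojourn_lt_top P hL hβ he hρ₁ (β + 1)
  have hfin0 : meanSojourn L 0 β P β < ∞ :=
    meanSojourn_lt_top P hL hβ he (by simpa using hlt) β
  set Q := Measure.infinitePi fun _ : ℕ => P
  have hmeas : ∀ {g : ℝ≥0 → E → ℝ≥0} {h : ℝ≥0 → ℝ≥0∞} {w : ℝ≥0 → ℝ≥0 → ℝ≥0∞}
      (_ : Measurable g.uncurry) (_ : Measurable h) (_ : Measurable w.uncurry) (r : ℝ≥0),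
      Measurable fun x => ∑' k, pathTerm g h w r x k := fun hg hh hw r =>
    Measurable.tsum fun k => (measurable_pathTerm hg hh hw k).comp
      (measurable_const.prodMk measurable_id)
  have hlim : meanSojourn L 0 β P β + c * meanExit P L 0 β β =
      ∫⁻ x, (∑' k, pathTerm (obsStep L 0) (obsReward β) (sojournWeight β) β x k +
        c * ∑' k, pathTerm (obsStep L 0) (exitReward β) (sojournWeight β) β x k) ∂Q := by
    rw [lintegral_add_left (hmeas (measurable_obsStep hL) (measurable_obsReward β)
      (measurable_sojournWeight β) _), lintegral_const_mul _ (hmeas (measurable_obsStep hL)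
      measurable_exitReward (measurable_sojournWeight β) _), meanSojourn, meanExit,
      potential_eq_lintegral P (measurable_obsStep hL) (measurable_obsReward β)
      (measurable_sojournWeight β), potential_eq_lintegral P (measurable_obsStep hL)
      measurable_exitReward (measurable_sojournWeight β)]
  rw [hlim]
  simp only [cyclePotential, potential_eq_lintegral P (measurable_obsStep hL)
    (measurable_cycleReward β c) (measurable_cycleWeight β _)]
  rw [meanSojourn, potential_eq_lintegral P (measurable_obsStep hL) (measurable_obsReward β)
    (measurable_sojournWeight β)] at hfin
  refine tendsto_lintegral_filter_of_dominated_convergence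
    -- The dominating function is the drop time of the path with the larger parameter `ρ₁` and start
    -- `β + 1`, plus the terminal reward. It is infinite on paths that never drop.
    (fun x => ∑' k, pathTerm (obsStep L ρ₁) (obsReward β) (sojournWeight β) (β + 1) x k + c)
    (Eventually.of_forall fun z => hmeas (measurable_obsStep hL) (measurable_cycleReward β c)
      (measurable_cycleWeight β _) _) ?_ ?_ ?_
  · have h1 : ∀ᶠ z : (ℝ≥0 × ℝ≥0) × ℝ≥0 in (atTop ×ˢ 𝓝 0) ×ˢ 𝓝[≥] β, z.1.2 ≤ ρ₁ :=
      (((ge_mem_nhds hρ₁0).prod_inr atTop).prod_inl _)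
    have h2 : ∀ᶠ z : (ℝ≥0 × ℝ≥0) × ℝ≥0 in (atTop ×ˢ 𝓝 0) ×ˢ 𝓝[≥] β, z.2 ≤ β + 1 :=
      Eventually.prod_inr (nhdsWithin_le_nhds (ge_mem_nhds (lt_add_one β))) _
    filter_upwards [h1, h2] with z hz1 hz2
    refine Eventually.of_forall fun x => ?_
    by_cases hx : ∃ n, chain (obsStep L ρ₁) (β + 1) x n < β
    · obtain ⟨n, hn⟩ := exists_firstBelow hx
      have hx' : ∃ n, chain (obsStep L z.1.2) z.2 x n < β :=
        ⟨n, (chain_obsStep_mono hρ₁1 hz1 hz2 x n).trans_lt hn.2⟩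
      obtain ⟨n', hn'⟩ := exists_firstBelow hx'
      rw [tsum_pathTerm_sojourn hn]
      refine (tsum_pathTerm_cycle_le hn').trans ?_
      gcongr
      -- If the lower path dropped after time `n`, it would be at least `β` at time `n`, where the
      -- upper path is already below `β`.
      by_contra! hcon
      exact ((hn'.1 n hcon).trans (chain_obsStep_mono hρ₁1 hz1 hz2 x n)).not_gt hn.2
    · rw [tsum_pathTerm_sojourn_eq_top (by simpa using hx)]
      simp
  · rw [lintegral_add_right _ measurable_const]
    simp [hfin.ne, ENNReal.add_eq_top]
  · filter_upwards [ae_exists_firstBelow P hL hfin0] with x ⟨n, hn⟩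
    rw [tsum_pathTerm_sojourn hn, tsum_pathTerm_exit hn]
    exact tendsto_tsum_pathTerm_cycle (tendsto_fst.comp tendsto_fst)
      (tendsto_snd.comp tendsto_fst) tendsto_snd c hn

lemma tendsto_meanSojourn (hL : Measurable L) (hβ : 0 < β) {e : ℝ≥0}
    (he : ∫⁻ y, (NNReal.sqrt (L y) : ℝ≥0∞) ∂P = e) (hlt : e < 1) :
    Tendsto (fun ρ => meanSojourn L ρ β P β) (𝓝 0) (𝓝 (meanSojourn L 0 β P β)) := by
  obtain ⟨ρ₁, hρ₁0, hρ₁1, hρ₁⟩ := exists_pos_sqrt_mul_lt_one hlt β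
  have hfin := meanSojourn_lt_top P hL hβ he hρ₁ β
  have hfin0 : meanSojourn L 0 β P β < ∞ :=
    meanSojourn_lt_top P hL hβ he (by simpa using hlt) β
  have hae := ae_exists_firstBelow P hL hfin0
  have hmeas : ∀ ρ, Measurable fun x => ∑' k, pathTerm (obsStep L ρ) (obsReward β)
      (sojournWeight β) β x k := fun ρ =>
    Measurable.tsum fun k => (measurable_pathTerm (measurable_obsStep hL)
      (measurable_obsReward β) (measurable_sojournWeight β) k).comp
      (measurable_const.prodMk measurable_id)
  simp only [meanSojourn, potential_eq_lintegral P (measurable_obsStep hL) (measurable_obsReward β)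
    (measurable_sojournWeight β)] at hfin ⊢
  refine tendsto_lintegral_filter_of_dominated_convergence _
    (Eventually.of_forall hmeas) ?_ hfin.ne ?_
  · filter_upwards [ge_mem_nhds hρ₁0] with ρ hρ
    refine Eventually.of_forall fun x => ?_
    by_cases hx : ∃ n, chain (obsStep L ρ₁) β x n < β
    · obtain ⟨n, hn⟩ := exists_firstBelow hx
      obtain ⟨n', hn'⟩ := exists_firstBelow
        ⟨n, (chain_obsStep_mono hρ₁1 hρ le_rfl x n).trans_lt hn.2⟩
      rw [tsum_pathTerm_sojourn hn, tsum_pathTerm_sojourn hn']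
      gcongr
      by_contra! hcon
      exact ((hn'.1 n hcon).trans (chain_obsStep_mono hρ₁1 hρ le_rfl x n)).not_gt hn.2
    · rw [tsum_pathTerm_sojourn_eq_top (g := obsStep L ρ₁) (by simpa using hx)]
      exact le_top
  · filter_upwards [hae] with x ⟨n, hn⟩
    have hpair : Tendsto (fun ρ : ℝ≥0 => (ρ, β)) (𝓝 0) (𝓝 0 ×ˢ 𝓝[≥] β) :=
      tendsto_id.prodMk (tendsto_const_nhdsWithin (Set.self_mem_Ici (a := β)))
    rw [tsum_pathTerm_sojourn hn]
    refine tendsto_const_nhds.congr' ?_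
    filter_upwards [hpair.eventually (eventually_firstBelow hn)] with ρ hρ
    rw [tsum_pathTerm_sojourn hρ]

/-- The drop is strict, so the exit reward is almost surely less than `1`. This is what makes `1 -
H` positive. -/
lemma meanExit_lt_one (hL : Measurable L) (h : meanSojourn L ρ β P β < ∞) :
    meanExit P L ρ β β < 1 := by
  rw [meanExit, potential_eq_lintegral P (measurable_obsStep hL) measurable_exitReward
    (measurable_sojournWeight β)]
  have hlt : ∀ᵐ x ∂(Measure.infinitePi fun _ : ℕ => P),
      ∑' k, pathTerm (obsStep L ρ) (exitReward β) (sojournWeight β) β x k < 1 := by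
    filter_upwards [ae_exists_firstBelow P hL h] with x ⟨n, hn⟩
    rw [tsum_pathTerm_exit hn, exitReward, if_neg hn.2.not_ge]
    norm_cast
    rw [div_lt_one (by positivity)]
    gcongr
    exact hn.2
  have hle := lintegral_mono_ae (hlt.mono fun x hx => hx.le)
  have := lintegral_strict_mono (μ := Measure.infinitePi fun _ : ℕ => P)
    (g := fun _ => (1 : ℝ≥0∞)) (IsProbabilityMeasure.ne_zero _) aemeasurable_const
    (by refine (hle.trans_lt ?_).ne; simp) hlt
  simpa using this

lemma one_le_meanSojourn : 1 ≤ meanSojourn L ρ β P β := by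
  refine le_trans ?_ (ENNReal.le_tsum 0)
  rw [meanTerm_zero, obsReward, if_pos le_rfl]

end FirstDrop

/-! ### The renewal equation and the limit of the discounted count. -/

section Renewal

variable {E : Type*} [MeasurableSpace E] {L : E → ℝ≥0} {β : ℝ≥0} (P : Measure E)
  [IsProbabilityMeasure P]

lemma tendsto_skipOdds (β : ℝ≥0) : Tendsto (fun ρ => skipOdds ρ β) (𝓝 0) (𝓝 β) := by
  have h : ContinuousAt (fun ρ : ℝ≥0 => (β + ρ) / (1 - ρ)) 0 :=
    ContinuousAt.div (by fun_prop) (continuous_const.sub continuous_id).continuousAt (by simp)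
  simpa [skipOdds, ContinuousAt] using h

/-- The re-entry window `[β, skipOdds ρ β]` shrinks to `β`, so a joint limit is uniform over it. -/
lemma eventually_forall_le_skipOdds {l : Filter (ℝ≥0 × ℝ≥0)} (hl : Tendsto Prod.snd l (𝓝 0))
    {p : (ℝ≥0 × ℝ≥0) × ℝ≥0 → Prop} (hp : ∀ᶠ z in l ×ˢ 𝓝[≥] β, p z) :
    ∀ᶠ q in l, ∀ r, β ≤ r → r ≤ skipOdds q.2 β → p (q, r) := by
  obtain ⟨pa, ha, pb, hb, hab⟩ := Filter.eventually_prod_iff.1 hp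
  obtain ⟨u, hu, hub⟩ := (mem_nhdsGE_iff_exists_Ico_subset' (lt_add_one β)).1 hb
  filter_upwards [ha, ((tendsto_skipOdds β).comp hl).eventually (gt_mem_nhds hu)] with q hq1 hq2
  exact fun r hr1 hr2 => hab hq1 (hub ⟨hr1, hr2.trans_lt hq2⟩)

/-- At `r = β` the closed form of the terminal reward does not apply, but its value there would be
`c`, which the re-entry hypotheses compare with the potential. -/
lemma cyclePotential_eq_or {c α ρ r : ℝ≥0} (hL : Measurable L) (hr : r ≤ β) :
    cyclePotential L ρ β α c P r = ((c * ((1 + r) / (1 + β)) : ℝ≥0) : ℝ≥0∞) ∨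
      r = β ∧ c * ((1 + r) / (1 + β)) = c := by
  rcases hr.lt_or_eq with h | h
  · exact Or.inl (cyclePotential_of_lt P hL h)
  · refine Or.inr ⟨h, ?_⟩
    rw [h, div_self (by positivity), mul_one]

lemma tendsto_discountedObs (hL : Measurable L) (hβ : 0 < β) {e : ℝ≥0}
    (he : ∫⁻ y, (NNReal.sqrt (L y) : ℝ≥0∞) ∂P = e) (hlt : e < 1) {r : ℝ≥0} (hr : r ≤ β)
    {m H : ℝ≥0} (hm : meanSojourn L 0 β P β = m) (hH : meanExit P L 0 β β = H) (hH1 : H < 1) :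
    Tendsto (fun q : ℝ≥0 × ℝ≥0 => discountedObs L q.2 β q.1 P r) (atTop ×ˢ 𝓝[>] 0)
      (𝓝 ((m / (1 - H) * ((1 + r) / (1 + β)) : ℝ≥0) : ℝ≥0∞)) := by
  set t := (1 + r) / (1 + β) with ht
  have htpos : 0 < t := by positivity
  have h1H : 0 < 1 - H := tsub_pos_of_lt hH1
  set l : Filter (ℝ≥0 × ℝ≥0) := atTop ×ˢ 𝓝[>] 0 with hl
  have hsnd' : Tendsto Prod.snd l (𝓝[>] 0) := tendsto_snd
  have hsnd : Tendsto Prod.snd l (𝓝 0) := hsnd'.mono_right nhdsWithin_le_nhds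
  have hll : l ≤ atTop ×ˢ 𝓝 0 := prod_mono le_rfl nhdsWithin_le_nhds
  have hρ1 : ∀ᶠ q in l, q.2 < 1 := hsnd.eventually (gt_mem_nhds one_pos)
  have hρ0 : ∀ᶠ q in l, 0 < q.2 := hsnd'.eventually self_mem_nhdsWithin
  have hα : ∀ᶠ q in l, skipOdds q.2 β ≤ q.1 := by
    have h1 : ∀ᶠ q in l, β + 1 ≤ q.1 := (eventually_ge_atTop _).prod_inl _
    filter_upwards [h1, ((tendsto_skipOdds β).comp hsnd).eventually
      (ge_mem_nhds (lt_add_one β))] with q h1 h2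
    exact h2.trans h1
  have hU : ∀ c : ℝ≥0, Tendsto
      (fun z : (ℝ≥0 × ℝ≥0) × ℝ≥0 => cyclePotential L z.1.2 β z.1.1 c P z.2)
      (l ×ˢ 𝓝[≥] β) (𝓝 ((m + c * H : ℝ≥0) : ℝ≥0∞)) := by
    intro c
    have := tendsto_cyclePotential P hL hβ he hlt c
    rw [hm, hH] at this
    push_cast
    exact this.mono_left (prod_mono hll le_rfl)
  have hupper : ∀ c : ℝ≥0, m / (1 - H) < c → ∀ᶠ q in l,
      discountedObs L q.2 β q.1 P r ≤ ((c * t : ℝ≥0) : ℝ≥0∞) := by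
    intro c hc
    rw [div_lt_iff₀ h1H] at hc
    -- Strictness is essential: it survives replacing the limit `m + c H` by the potentials nearby.
    have hc' : m + c * H < c := by
      calc m + c * H < c * (1 - H) + c * H := by gcongr
        _ = c := by rw [← mul_add, tsub_add_cancel_of_le hH1.le, mul_one]
    have hev := eventually_forall_le_skipOdds hsnd
      ((hU c).eventually (ge_mem_nhds (ENNReal.coe_lt_coe.2 hc')))
    filter_upwards [hev, hρ1] with q hq hq1
    refine (discountedObs_le P hL hq1 hq r).trans ?_
    rcases cyclePotential_eq_or P (c := c) (α := q.1) (ρ := q.2) hL hr with h | ⟨h1, h2⟩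
    · exact h.le
    · rw [h2, h1]
      exact hq β le_rfl (by
        rw [skipOdds, le_div_iff₀ (tsub_pos_of_lt hq1)]
        exact (mul_le_of_le_one_right zero_le tsub_le_self).trans le_self_add)
  have hlower : ∀ c : ℝ≥0, c < m / (1 - H) → ∀ᶠ q in l,
      ((c * t : ℝ≥0) : ℝ≥0∞) ≤ discountedObs L q.2 β q.1 P r := by
    intro c hc
    rw [lt_div_iff₀ h1H] at hc
    have hc' : c < m + c * H := by
      calc c = c * (1 - H) + c * H := by rw [← mul_add, tsub_add_cancel_of_le hH1.le, mul_one]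
        _ < m + c * H := by gcongr
    have hd : Tendsto (fun z : (ℝ≥0 × ℝ≥0) × ℝ≥0 => ((1 - z.1.2 : ℝ≥0) : ℝ≥0∞))
        (l ×ˢ 𝓝[≥] β) (𝓝 1) := by
      have h0 := tendsto_coe_one_sub.comp (hsnd.comp (tendsto_fst (f := l) (g := 𝓝[≥] β)))
      exact h0
    have hmul := ENNReal.Tendsto.mul hd (Or.inl one_ne_zero) (hU c) (Or.inr ENNReal.one_ne_top)
    rw [one_mul] at hmul
    have hev := eventually_forall_le_skipOdds hsnd
      (hmul.eventually (le_mem_nhds (ENNReal.coe_lt_coe.2 hc')))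
    filter_upwards [hev, hρ1, hρ0, hα] with q hq hq1 hq0 hqα
    refine le_trans ?_ (le_discountedObs P hL hq1 hq0 hqα hq r)
    rcases cyclePotential_eq_or P (c := c) (α := q.1) (ρ := q.2) hL hr with h | ⟨h1, h2⟩
    · exact h.ge
    · rw [h2, h1]
      refine (hq β le_rfl ?_).trans (mul_le_of_le_one_left zero_le ?_)
      · rw [skipOdds, le_div_iff₀ (tsub_pos_of_lt hq1)]
        exact (mul_le_of_le_one_right zero_le tsub_le_self).trans le_self_add
      · exact_mod_cast tsub_le_self
  refine tendsto_order.2 ⟨fun a ha => ?_, fun a ha => ?_⟩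
  · lift a to ℝ≥0 using (ha.trans ENNReal.coe_lt_top).ne
    rw [ENNReal.coe_lt_coe, ← div_lt_iff₀ htpos] at ha
    obtain ⟨c, hc1, hc2⟩ := exists_between ha
    filter_upwards [hlower c hc2] with q hq
    refine lt_of_lt_of_le ?_ hq
    rw [ENNReal.coe_lt_coe]
    exact (div_lt_iff₀ htpos).1 hc1
  · obtain ⟨a', ha1, ha2⟩ := ENNReal.lt_iff_exists_nnreal_btwn.1 ha
    rw [ENNReal.coe_lt_coe, ← lt_div_iff₀ htpos] at ha1
    obtain ⟨c, hc1, hc2⟩ := exists_between ha1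
    filter_upwards [hupper c hc1] with q hq
    refine hq.trans_lt (lt_trans ?_ ha2)
    rw [ENNReal.coe_lt_coe]
    exact (lt_div_iff₀ htpos).1 hc2

end Renewal

/-! ### Passage from beliefs and log-odds to odds. -/

section Belief

/-- The belief whose odds are `r`. -/
def oddsBelief (r : ℝ≥0) : ℝ := r / (1 + r)

lemma logOdds_oddsBelief (r : ℝ≥0) : logOdds (oddsBelief r) = ENNReal.log r := by
  have h : (0 : ℝ) < 1 + r := by positivity
  have h1 : 1 - oddsBelief r = 1 / (1 + r) := by rw [oddsBelief]; field_simp; ring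
  rw [logOdds, h1, ← ENNReal.ofReal_div_of_pos (by positivity), oddsBelief, div_div_div_cancel_right₀ h.ne',
    div_one, ENNReal.ofReal_coe_nnreal]

/-- The odds `e ^ b`. -/
def expOdds (b : ℝ) : ℝ≥0 := Real.toNNReal (Real.exp b)

lemma coe_expOdds (b : ℝ) : (expOdds b : ℝ) = Real.exp b :=
  Real.coe_toNNReal _ (Real.exp_pos b).le

lemma expOdds_pos (b : ℝ) : 0 < expOdds b := Real.toNNReal_pos.2 (Real.exp_pos b)

lemma log_expOdds (b : ℝ) : ENNReal.log (expOdds b) = (b : EReal) := by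
  rw [ENNReal.log_of_nnreal (expOdds_pos b).ne', coe_expOdds, Real.log_exp]

lemma beliefOf_eq (b : ℝ) : beliefOf b = oddsBelief (expOdds b) := by
  rw [beliefOf, oddsBelief, coe_expOdds]

lemma le_logOdds_iff (b : ℝ) (r : ℝ≥0) : (b : EReal) ≤ logOdds (oddsBelief r) ↔ expOdds b ≤ r := by
  rw [logOdds_oddsBelief, ← log_expOdds, ENNReal.log_le_log_iff, ENNReal.coe_le_coe]

lemma lt_logOdds_iff (b : ℝ) (r : ℝ≥0) : (b : EReal) < logOdds (oddsBelief r) ↔ expOdds b < r := by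
  rw [logOdds_oddsBelief, ← log_expOdds, ENNReal.log_lt_log_iff, ENNReal.coe_lt_coe]

lemma skipUpdate_oddsBelief {ρ : ℝ≥0} (hρ : ρ < 1) (r : ℝ≥0) :
    skipUpdate ρ (oddsBelief r) = oddsBelief (skipOdds ρ r) := by
  have h : (0 : ℝ) < 1 - ρ := sub_pos.2 (by exact_mod_cast hρ)
  have h' : (0 : ℝ) < 1 + r := by positivity
  have h'' : (0 : ℝ) < 1 - ρ + (r + ρ) := by linarith
  rw [oddsBelief, oddsBelief, skipOdds, skipUpdate, NNReal.coe_div, NNReal.coe_sub hρ.le]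
  push_cast
  field_simp
  ring

/-- Bayes' rule is multiplicative in the odds. Positivity of `u` is needed to form the ratio and
holds `P₀`-almost surely for the density. -/
lemma takeUpdate_oddsBelief {ρ : ℝ≥0} (hρ : ρ < 1) (r : ℝ≥0) {u : ℝ≥0} (hu : 0 < u) (v : ℝ≥0) :
    takeUpdate ρ u v (oddsBelief r) = oddsBelief (skipOdds ρ r * (v / u)) := by
  rw [takeUpdate, skipUpdate_oddsBelief hρ]
  generalize skipOdds ρ r = s
  have h1 : (0 : ℝ) < 1 + s := by positivity
  have h2 : (0 : ℝ) < u := by exact_mod_cast hu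
  have h3 : (0 : ℝ) < u + s * v := by positivity
  have h4 : oddsBelief s * v + (1 - oddsBelief s) * u = (u + s * v) / (1 + s) := by
    rw [oddsBelief]; field_simp; ring
  have h5 : (1 : ℝ) + s * (v / u) = (u + s * v) / u := by field_simp
  rw [h4, oddsBelief, oddsBelief]
  push_cast
  rw [h5]
  field_simp

lemma exists_oddsBelief_eq {p : ℝ} (h0 : 0 ≤ p) {b : ℝ} (hb : logOdds p ≤ b) :
    ∃ r : ℝ≥0, r ≤ expOdds b ∧ oddsBelief r = p ∧ p < 1 := by
  have hp : p < 1 := by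
    by_contra! h
    have h1 : ENNReal.ofReal (1 - p) = 0 := ENNReal.ofReal_of_nonpos (by linarith)
    rw [logOdds, h1, ENNReal.div_zero (ENNReal.ofReal_pos.2 (by linarith)).ne',
      ENNReal.log_top] at hb
    exact absurd hb (by simp)
  have hr : 0 ≤ p / (1 - p) := div_nonneg h0 (by linarith)
  have heq : oddsBelief (p / (1 - p)).toNNReal = p := by
    have : (1 - p) ≠ 0 := by linarith
    rw [oddsBelief, Real.coe_toNNReal _ hr]
    field_simp
    ring
  refine ⟨(p / (1 - p)).toNNReal, ?_, heq, hp⟩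
  rw [← heq, logOdds_oddsBelief, ← log_expOdds, ENNReal.log_le_log_iff, ENNReal.coe_le_coe] at hb
  exact hb

variable {E : Type*} {f₀ f₁ : E → ℝ≥0} {ρ : ℝ≥0}

lemma belief_eq_oddsBelief (hρ : ρ < 1) (b : ℝ) (r : ℝ≥0) {x : ℕ → E}
    (hx : ∀ n, 0 < f₀ (x (n + 1))) (k : ℕ) :
    belief f₀ f₁ ρ b (oddsBelief r) x k =
      oddsBelief (chain (controlledStep (fun y => f₁ y / f₀ y) ρ (expOdds b)) r x k) := by
  induction k with
  | zero => rfl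
  | succ k ih =>
    rw [belief, ih, chain, controlledStep]
    simp only [le_logOdds_iff]
    split_ifs
    · exact takeUpdate_oddsBelief hρ _ (hx k) _
    · exact skipUpdate_oddsBelief hρ _

lemma lt_firstTime_iff {Q : ℕ → Prop} {n : ℕ} : (n : ℕ∞) < firstTime Q ↔ ∀ k ≤ n, ¬ Q k := by
  rw [firstTime, ← ENat.add_one_le_iff (ENat.natCast_ne_top n)]
  simp only [le_iInf_iff]
  norm_cast
  constructor
  · intro h k hk hQ
    exact absurd (h k hQ) (by omega)
  · intro h k hQ
    by_contra! hk
    exact h k (by omega) hQ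

lemma controlled_eq_obs {L : E → ℝ≥0} {β r : ℝ≥0} {x : ℕ → E} {k : ℕ}
    (h : ∀ j < k, β ≤ chain (obsStep L ρ) r x j) :
    chain (controlledStep L ρ β) r x k = chain (obsStep L ρ) r x k := by
  induction k with
  | zero => rfl
  | succ k ih =>
    rw [chain, chain, ih fun j hj => h j (by omega), controlledStep, if_pos (h k (by omega))]

lemma controlled_eq_obs' {L : E → ℝ≥0} {β r : ℝ≥0} {x : ℕ → E} {k : ℕ}
    (h : ∀ j < k, β ≤ chain (controlledStep L ρ β) r x j) :
    chain (controlledStep L ρ β) r x k = chain (obsStep L ρ) r x k := by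
  induction k with
  | zero => rfl
  | succ k ih =>
    rw [chain, chain, ← ih fun j hj => h j (by omega), controlledStep, if_pos (h k (by omega))]

end Belief

/-! ### Hellinger affinity of the two laws. -/

section Affinity

variable {E : Type*} [MeasurableSpace E] {μ : Measure E} {f₀ f₁ : E → ℝ≥0}

lemma ae_pos_withDensity (hf₀ : Measurable f₀) :
    ∀ᵐ x ∂(μ.withDensity fun x => (f₀ x : ℝ≥0∞)), 0 < f₀ x := by
  rw [ae_withDensity_iff hf₀.coe_nnreal_ennreal]
  refine Eventually.of_forall fun x hx => ?_
  rw [ne_eq, ENNReal.coe_eq_zero] at hx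
  exact pos_iff_ne_zero.2 hx

/-- The affinity of two distinct laws is less than `1`. -/
lemma lintegral_sqrt_ratio_lt_one (hf₀ : Measurable f₀) (hf₁ : Measurable f₁)
    {P₀ P₁ : Measure E} [IsProbabilityMeasure P₀] [IsProbabilityMeasure P₁]
    (hP₀ : P₀ = μ.withDensity fun x => (f₀ x : ℝ≥0∞))
    (hP₁ : P₁ = μ.withDensity fun x => (f₁ x : ℝ≥0∞)) (hne : P₀ ≠ P₁) :
    ∫⁻ y, (NNReal.sqrt (f₁ y / f₀ y) : ℝ≥0∞) ∂P₀ < 1 := by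
  -- Only an inequality, as `P₁` may charge the set where `f₀ = 0`.
  have hratio : ∫⁻ y, ((f₁ y / f₀ y : ℝ≥0) : ℝ≥0∞) ∂P₀ ≤ 1 := by
    rw [hP₀, lintegral_withDensity_eq_lintegral_mul _ hf₀.coe_nnreal_ennreal (by fun_prop)]
    calc _ ≤ ∫⁻ y, (f₁ y : ℝ≥0∞) ∂μ := by
          refine lintegral_mono fun y => ?_
          rw [Pi.mul_apply, ← ENNReal.coe_mul, ENNReal.coe_le_coe]
          rcases eq_or_ne (f₀ y) 0 with h | h
          · simp [h]
          · rw [mul_div_cancel₀ _ h]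
      _ = P₁ Set.univ := by rw [hP₁, withDensity_apply _ MeasurableSet.univ, setLIntegral_univ]
      _ = 1 := measure_univ
  by_contra! hge
  have hle : ∀ y, (NNReal.sqrt (f₁ y / f₀ y) : ℝ≥0∞) ≤ ((1 + f₁ y / f₀ y) / 2 : ℝ≥0) := by
    intro y
    rw [ENNReal.coe_le_coe]
    generalize f₁ y / f₀ y = z
    rw [← NNReal.coe_le_coe]
    push_cast
    nlinarith [sq_nonneg (Real.sqrt z - 1), Real.sq_sqrt z.coe_nonneg]
  have hmean : ∫⁻ y, (((1 + f₁ y / f₀ y) / 2 : ℝ≥0) : ℝ≥0∞) ∂P₀ ≤ 1 := by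
    have h1 : ∀ y, (((1 + f₁ y / f₀ y) / 2 : ℝ≥0) : ℝ≥0∞) =
        2⁻¹ * (1 + ((f₁ y / f₀ y : ℝ≥0) : ℝ≥0∞)) := by
      intro y
      rw [div_eq_mul_inv _ (2 : ℝ≥0), mul_comm]
      push_cast
      rfl
    simp only [h1]
    rw [lintegral_const_mul _ (by fun_prop), lintegral_add_left measurable_const, lintegral_one,
      measure_univ]
    calc _ ≤ (2 : ℝ≥0∞)⁻¹ * (1 + 1) := by gcongr
      _ = 1 := by rw [one_add_one_eq_two, ENNReal.inv_mul_cancel (by simp) (by simp)]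
  -- Affinity at least `1` forces equality almost everywhere in `√z ≤ (1 + z) / 2`, hence `z = 1`.
  have hae := ae_eq_of_ae_le_of_lintegral_le (Eventually.of_forall hle)
    (((lintegral_mono hle).trans hmean).trans_lt ENNReal.one_lt_top).ne
    (by fun_prop) (hmean.trans hge)
  have hone : ∀ᵐ y ∂P₀, f₁ y / f₀ y = 1 := by
    filter_upwards [hae] with y hy
    rw [ENNReal.coe_inj] at hy
    generalize f₁ y / f₀ y = z at hy
    have h2 : Real.sqrt z = (1 + z) / 2 := by
      rw [← Real.coe_sqrt, hy]; push_cast; rfl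
    have h3 : Real.sqrt z = 1 := by
      have h5 := Real.sq_sqrt z.coe_nonneg
      have h6 : (Real.sqrt z - 1) ^ 2 = 0 := by linear_combination h5 - 2 * h2
      exact sub_eq_zero.1 (pow_eq_zero_iff two_ne_zero |>.1 h6)
    have h4 : (z : ℝ) = 1 := by linarith
    exact_mod_cast h4
  -- Where `f₀ = 0` nothing is known about `f₁`, so only `≤` results; two probability measures
  -- ordered this way coincide.
  have hfle : ∀ᵐ y ∂μ, (f₀ y : ℝ≥0∞) ≤ f₁ y := by
    rw [hP₀, ae_withDensity_iff hf₀.coe_nnreal_ennreal] at hone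
    filter_upwards [hone] with y hy
    by_cases h : f₀ y = 0
    · simp [h]
    · have := hy (by simpa using h)
      rw [div_eq_one_iff_eq h] at this
      rw [this]
  have hle01 : P₀ ≤ P₁ := by
    rw [hP₀, hP₁]
    exact withDensity_mono hfle
  refine hne (Measure.ext fun s hs => le_antisymm (hle01 s) ?_)
  rw [← compl_compl s, prob_compl_eq_one_sub hs.compl, prob_compl_eq_one_sub hs.compl]
  exact tsub_le_tsub_left (hle01 _) _

end Affinity

/-! ### Laws of the observations, the prior, and measurability. -/

section ObsLaw

variable {E : Type*} [MeasurableSpace E] (P₀ P₁ : Measure E)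

lemma obsLaw_top : obsLaw P₀ P₁ ⊤ = Measure.infinitePi fun _ : ℕ => P₀ := by
  rw [obsLaw]
  congr 1

variable [IsProbabilityMeasure P₀] [IsProbabilityMeasure P₁]

/-- Before the change, the observations are distributed as if there were no change. -/
lemma lintegral_obsLaw_eq_top {F : (ℕ → E) → ℝ≥0∞} (hF : Measurable F) {k : ℕ}
    (hdep : ∀ x y : ℕ → E, (∀ i ≤ k, x i = y i) → F x = F y) {ℓ : ℕ∞} (hk : (k : ℕ∞) < ℓ) :
    ∫⁻ x, F x ∂(obsLaw P₀ P₁ ℓ) = ∫⁻ x, F x ∂(obsLaw P₀ P₁ ⊤) := by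
  classical
  obtain ⟨e₀⟩ : Nonempty E := nonempty_of_isProbabilityMeasure P₀
  -- The padding value is arbitrary: `F` sees only the coordinates up to `k`.
  let ext : (Finset.Iic k → E) → ℕ → E := fun z n => if h : n ∈ Finset.Iic k then z ⟨n, h⟩ else e₀
  have hext : Measurable ext := by
    refine measurable_pi_lambda _ fun n => ?_
    by_cases h : n ∈ Finset.Iic k
    · simp only [ext, h, dif_pos]; exact measurable_pi_apply _
    · simp only [ext, h, dif_neg, not_false_eq_true]; exact measurable_const
  have hFe : ∀ x, F x = F (ext ((Finset.Iic k).restrict x)) := fun x => by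
    refine hdep _ _ fun i hi => ?_
    simp [ext, hi]
  have hred : ∀ ℓ' : ℕ∞, ∫⁻ x, F x ∂(obsLaw P₀ P₁ ℓ') =
      ∫⁻ z, F (ext z) ∂(Measure.pi fun i : Finset.Iic k => marginal P₀ P₁ ℓ' i) := by
    intro ℓ'
    rw [← Measure.infinitePi_map_restrict (marginal P₀ P₁ ℓ')]
    exact (lintegral_congr hFe).trans
      (lintegral_map (hF.comp hext) (Finset.measurable_restrict _)).symm
  rw [hred, hred]
  congr 2
  funext i
  have h1 : ((i : ℕ) : ℕ∞) < ℓ :=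
    lt_of_le_of_lt (by exact_mod_cast Finset.mem_Iic.1 i.2) hk
  simp [marginal, h1]

lemma ae_forall_eval {p : E → Prop} (hp : ∀ᵐ y ∂P₀, p y) :
    ∀ᵐ x ∂(Measure.infinitePi fun _ : ℕ => P₀), ∀ n, p (x (n + 1)) := by
  refine ae_all_iff.2 fun n => ?_
  exact (measurePreserving_eval_infinitePi (fun _ : ℕ => P₀) (n + 1)).quasiMeasurePreserving.ae hp

end ObsLaw

section Prior

lemma tsum_priorWeight {ρ : ℝ≥0} (h0 : 0 < ρ) (h1 : ρ < 1) {π₀ : ℝ} (hπ : π₀ ≤ 1) (m : ℕ) :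
    ∑' ℓ : ℕ, (if m < ℓ then ENNReal.ofReal (priorWeight ρ π₀ ℓ) else 0) =
      ENNReal.ofReal (1 - π₀) * ((1 - ρ : ℝ≥0) : ℝ≥0∞) ^ m := by
  rw [← Summable.sum_add_tsum_nat_add' (k := m + 1) ENNReal.summable, Finset.sum_eq_zero, zero_add]
  · have hterm : ∀ i : ℕ, (if m < i + (m + 1) then
        ENNReal.ofReal (priorWeight ρ π₀ (i + (m + 1))) else 0) =
        ENNReal.ofReal (1 - π₀) * ((1 - ρ : ℝ≥0) : ℝ≥0∞) ^ m *
          (ρ * ((1 - ρ : ℝ≥0) : ℝ≥0∞) ^ i) := by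
      intro i
      have hcast : (1 - ρ : ℝ) = ((1 - ρ : ℝ≥0) : ℝ) := (NNReal.coe_sub h1.le).symm
      rw [if_pos (by omega), priorWeight, if_neg (by omega), hcast, mul_assoc,
        ENNReal.ofReal_mul (by linarith), ← NNReal.coe_pow, ← NNReal.coe_mul,
        ENNReal.ofReal_coe_nnreal, show i + (m + 1) - 1 = m + i by omega, pow_add]
      push_cast
      ring
    simp only [hterm]
    rw [ENNReal.tsum_mul_left, ENNReal.tsum_mul_left, ENNReal.tsum_geometric]
    have : (1 : ℝ≥0∞) - ((1 - ρ : ℝ≥0) : ℝ≥0∞) = ρ := by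
      rw [← ENNReal.coe_one, ← ENNReal.coe_sub, tsub_tsub_cancel_of_le h1.le]
    rw [this, ENNReal.mul_inv_cancel (by simpa using h0.ne') ENNReal.coe_ne_top, mul_one]
  · intro i hi
    rw [Finset.mem_range] at hi
    rw [if_neg (by omega)]

end Prior

section Measurability

variable {E : Type*} [MeasurableSpace E] {f₀ f₁ : E → ℝ≥0}

lemma measurable_logOdds : Measurable logOdds := by
  unfold logOdds
  fun_prop

lemma measurable_belief (hf₀ : Measurable f₀) (hf₁ : Measurable f₁) (ρ b p : ℝ) (k : ℕ) :
    Measurable fun x : ℕ → E => belief f₀ f₁ ρ b p x k := by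
  induction k with
  | zero => exact measurable_const
  | succ k ih =>
    have hset : MeasurableSet {x : ℕ → E | (b : EReal) ≤ logOdds (belief f₀ f₁ ρ b p x k)} :=
      measurableSet_le measurable_const (measurable_logOdds.comp ih)
    have h0 : Measurable fun x : ℕ → E => f₀ (x (k + 1)) := hf₀.comp (measurable_pi_apply _)
    have h1 : Measurable fun x : ℕ → E => f₁ (x (k + 1)) := hf₁.comp (measurable_pi_apply _)
    refine Measurable.ite hset ?_ ?_
    · unfold takeUpdate skipUpdate
      fun_prop
    · unfold skipUpdate
      fun_prop

lemma measurable_Z (hf₀ : Measurable f₀) (hf₁ : Measurable f₁) (ρ b p : ℝ) (k : ℕ) :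
    Measurable fun x : ℕ → E => Z f₀ f₁ ρ b p x k :=
  measurable_logOdds.comp (measurable_belief hf₀ hf₁ ρ b p k)

end Measurability

/-! ### The drop time `λ̂` in terms of the odds chain. -/

section HatLambda

variable {E : Type*} {f₀ f₁ : E → ℝ≥0}

lemma belief_congr (ρ b p : ℝ) {k : ℕ} {x y : ℕ → E} (h : ∀ i ≤ k, x i = y i) :
    belief f₀ f₁ ρ b p x k = belief f₀ f₁ ρ b p y k := by
  induction k with
  | zero => rfl
  | succ k ih => rw [belief, belief, ih fun i hi => h i (by omega), h (k + 1) le_rfl]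

variable (b : ℝ) {ρ : ℝ≥0}

/-- Until the first drop every observation is taken, so the controlled and the fully observed chains
agree. Time `0`, excluded from `λ̂`, is harmless since the start is exactly `β`. -/
lemma lt_hatLambda_iff (h1 : ρ < 1) {x : ℕ → E} (hx : ∀ n, 0 < f₀ (x (n + 1))) (n : ℕ) :
    (n : ℕ∞) < hatLambda f₀ f₁ ρ b x ↔ ∀ j ≤ n,
      expOdds b ≤ chain (obsStep (fun y => f₁ y / f₀ y) ρ) (expOdds b) x j := by
  have hZ : ∀ j, Z f₀ f₁ ρ b (beliefOf b) x j = logOdds (oddsBelief (chain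
      (controlledStep (fun y => f₁ y / f₀ y) ρ (expOdds b)) (expOdds b) x j)) := fun j => by
    rw [Z, beliefOf_eq, belief_eq_oddsBelief h1 b _ hx]
  rw [hatLambda, lt_firstTime_iff]
  simp only [hZ, not_and, not_lt, le_logOdds_iff]
  constructor
  · intro h j hj
    have h' : ∀ i ≤ n, expOdds b ≤ chain
        (controlledStep (fun y => f₁ y / f₀ y) ρ (expOdds b)) (expOdds b) x i := by
      rintro (_ | i) hi
      · exact le_rfl
      · exact h _ hi (by omega)
    rw [← controlled_eq_obs' fun i hi => h' i (by omega)]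
    exact h' j hj
  · intro h j hj _
    rw [controlled_eq_obs fun i hi => h i (by omega)]
    exact h j hj

lemma hatLambda_eq_of_firstBelow (h1 : ρ < 1) {x : ℕ → E} (hx : ∀ n, 0 < f₀ (x (n + 1))) {n : ℕ}
    (hn : FirstBelow (expOdds b)
      (chain (obsStep (fun y => f₁ y / f₀ y) ρ) (expOdds b) x) n) :
    hatLambda f₀ f₁ ρ b x = n := by
  refine le_antisymm ?_ ?_
  · by_contra! h
    exact ((lt_hatLambda_iff b h1 hx n).1 h n le_rfl).not_gt hn.2
  · by_contra! h
    lift hatLambda f₀ f₁ ρ b x to ℕ using (h.trans (ENat.natCast_lt_top n)).ne with m hm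
    have hmn : m < n := by exact_mod_cast h
    have := (lt_hatLambda_iff b h1 hx m).2 fun j hj => hn.1 j (by omega)
    rw [← hm] at this
    exact lt_irrefl _ this

end HatLambda

/-! ### The ANO as a discounted potential. -/

section Counts

variable {E : Type*} (f₀ f₁ : E → ℝ≥0) (ρ b p a : ℝ)

/-- The number of observations (`0` or `1`) used at time `k + 1`, if the policy has not stopped. -/
def obsIndicator (x : ℕ → E) (k : ℕ) : ℝ≥0∞ :=
  if (∀ j ≤ k, ¬ (1 ≤ j ∧ (a : EReal) < Z f₀ f₁ ρ b p x j)) ∧ (b : EReal) ≤ Z f₀ f₁ ρ b p x k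
  then 1 else 0

/-- The summand with index `k` is `S_{k+1}`; it counts when `k < τ` and `k + 1 < γ`. Separating the
two conditions lets the prior be integrated out. -/
lemma numObsBefore_eq (γ : ℕ) (x : ℕ → E) :
    (numObsBefore f₀ f₁ ρ b p a γ x : ℝ≥0∞) =
      ∑' k, if k + 1 < γ then obsIndicator f₀ f₁ ρ b p a x k else 0 := by
  set N := (min (stopTime f₀ f₁ ρ b p a x) ((γ - 1 : ℕ) : ℕ∞)).toNat with hN
  have hmem : ∀ k, k < N ↔ (k : ℕ∞) < stopTime f₀ f₁ ρ b p a x ∧ k + 1 < γ := by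
    intro k
    have hne : min (stopTime f₀ f₁ ρ b p a x) ((γ - 1 : ℕ) : ℕ∞) ≠ ⊤ :=
      ((min_le_right _ _).trans_lt (ENat.natCast_lt_top _)).ne
    rw [← Nat.cast_lt (α := ℕ∞), hN, ENat.natCast_toNat hne, lt_min_iff, Nat.cast_lt]
    exact and_congr_right fun _ => by omega
  rw [tsum_eq_sum (s := Finset.range N), numObsBefore, ← hN, Nat.cast_sum]
  · refine Finset.sum_congr rfl fun k hk => ?_
    obtain ⟨h1, h2⟩ := (hmem k).1 (Finset.mem_range.1 hk)
    rw [stopTime, lt_firstTime_iff] at h1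
    rw [if_pos h2, obsIndicator, samples]
    simp only [and_iff_right h1]
    split_ifs <;> simp
  · intro k hk
    rw [Finset.mem_range, hmem] at hk
    by_cases h2 : k + 1 < γ
    · rw [if_pos h2, obsIndicator, if_neg]
      rintro ⟨h3, -⟩
      exact hk ⟨by rw [stopTime, lt_firstTime_iff]; exact h3, h2⟩
    · rw [if_neg h2]

lemma obsIndicator_congr {k : ℕ} {x y : ℕ → E} (h : ∀ i ≤ k, x i = y i) :
    obsIndicator f₀ f₁ ρ b p a x k = obsIndicator f₀ f₁ ρ b p a y k := by
  have hZ : ∀ j ≤ k, Z f₀ f₁ ρ b p x j = Z f₀ f₁ ρ b p y j := fun j hj => by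
    rw [Z, Z, belief_congr ρ b p fun i hi => h i (hi.trans hj)]
  have h1 : (∀ j ≤ k, ¬ (1 ≤ j ∧ (a : EReal) < Z f₀ f₁ ρ b p x j)) ↔
      ∀ j ≤ k, ¬ (1 ≤ j ∧ (a : EReal) < Z f₀ f₁ ρ b p y j) :=
    forall₂_congr fun j hj => by rw [hZ j hj]
  rw [obsIndicator, obsIndicator, hZ k le_rfl]
  simp only [h1]

variable [MeasurableSpace E] {f₀ f₁}

lemma measurable_obsIndicator (hf₀ : Measurable f₀) (hf₁ : Measurable f₁) (k : ℕ) :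
    Measurable fun x => obsIndicator f₀ f₁ ρ b p a x k := by
  have hm := measurable_Z hf₀ hf₁ ρ b p
  have h1 : MeasurableSet {x : ℕ → E |
      ∀ j ≤ k, ¬ (1 ≤ j ∧ (a : EReal) < Z f₀ f₁ ρ b p x j)} := by
    have heq : {x : ℕ → E | ∀ j ≤ k, ¬ (1 ≤ j ∧ (a : EReal) < Z f₀ f₁ ρ b p x j)} =
        ⋂ j : ℕ, {x | j ≤ k → ¬ (1 ≤ j ∧ (a : EReal) < Z f₀ f₁ ρ b p x j)} := by
      ext x; simp
    rw [heq]
    refine MeasurableSet.iInter fun j => MeasurableSet.imp (MeasurableSet.const _) ?_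
    exact ((MeasurableSet.const _).inter (measurableSet_lt measurable_const (hm j))).compl
  exact Measurable.ite (h1.inter (measurableSet_le measurable_const (hm k))) measurable_const
    measurable_const

variable {ρ : ℝ≥0} (P₀ P₁ : Measure E) [IsProbabilityMeasure P₀]

lemma meanHatLambda_eq (hf₀ : Measurable f₀) (hf₁ : Measurable f₁)
    (hpos : ∀ᵐ y ∂P₀, 0 < f₀ y) (h1 : ρ < 1) :
    meanHatLambda P₀ P₁ f₀ f₁ b ρ =
      meanSojourn (fun y => f₁ y / f₀ y) ρ (expOdds b) P₀ (expOdds b) := by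
  rw [meanHatLambda, obsLaw_top, meanSojourn, potential_eq_lintegral P₀
    (measurable_obsStep (L := fun y => f₁ y / f₀ y) (hf₁.div hf₀)) (measurable_obsReward _) (measurable_sojournWeight _)]
  refine lintegral_congr_ae ?_
  filter_upwards [ae_forall_eval P₀ hpos] with x hx
  by_cases h : ∃ n, chain (obsStep (fun y => f₁ y / f₀ y) ρ) (expOdds b) x n < expOdds b
  · obtain ⟨n, hn⟩ := exists_firstBelow h
    rw [hatLambda_eq_of_firstBelow b h1 hx hn, tsum_pathTerm_sojourn hn]
    simp
  · push Not at h
    have htop : hatLambda f₀ f₁ ρ b x = ⊤ :=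
      ENat.eq_top_iff_forall_gt.2 fun n => (lt_hatLambda_iff b h1 hx n).2 fun j _ => h j
    rw [htop, tsum_pathTerm_sojourn_eq_top h]
    simp

variable [IsProbabilityMeasure P₁]

/-- The decision at time `k` uses only observations before the change when `k + 1 < Γ`, so it may be
averaged under `P_∞`; the prior then contributes its tail at `k + 1`. -/
lemma ANO_eq_tsum (hf₀ : Measurable f₀) (hf₁ : Measurable f₁) (h0 : 0 < ρ) (h1 : ρ < 1)
    {π₀ : ℝ} (hπ : π₀ ≤ 1) :
    ANO P₀ P₁ f₀ f₁ a b ρ π₀ = ENNReal.ofReal (1 - π₀) * ((1 - ρ : ℝ≥0) : ℝ≥0∞) *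
      ∑' k, ((1 - ρ : ℝ≥0) : ℝ≥0∞) ^ k *
        ∫⁻ x, obsIndicator f₀ f₁ ρ b π₀ a x k ∂(Measure.infinitePi fun _ : ℕ => P₀) := by
  have hI := fun k => measurable_obsIndicator (f₀ := f₀) (f₁ := f₁) ρ b π₀ a hf₀ hf₁ k
  have hmeas : Measurable fun ω : ℕ × (ℕ → E) =>
      ∑' k, if k + 1 < ω.1 then obsIndicator f₀ f₁ ρ b π₀ a ω.2 k else 0 := by
    refine Measurable.tsum fun k => Measurable.ite ?_ ((hI k).comp measurable_snd) measurable_const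
    exact measurableSet_lt measurable_const measurable_fst
  simp only [ANO, numObsBefore_eq, jointLaw]
  rw [lintegral_sum_measure]
  have hterm : ∀ ℓ : ℕ, ∫⁻ ω : ℕ × (ℕ → E), (∑' k, if k + 1 < ω.1 then
        obsIndicator f₀ f₁ ρ b π₀ a ω.2 k else 0)
        ∂(ENNReal.ofReal (priorWeight ρ π₀ ℓ) • (obsLaw P₀ P₁ (ℓ : ℕ∞)).map (Prod.mk ℓ)) =
      ∑' k, (if k + 1 < ℓ then ENNReal.ofReal (priorWeight ρ π₀ ℓ) else 0) *
        ∫⁻ x, obsIndicator f₀ f₁ ρ b π₀ a x k ∂(Measure.infinitePi fun _ : ℕ => P₀) := by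
    intro ℓ
    rw [lintegral_smul_measure, lintegral_map hmeas measurable_prodMk_left, lintegral_tsum,
      smul_eq_mul, ← ENNReal.tsum_mul_left]
    · refine tsum_congr fun k => ?_
      by_cases hk : k + 1 < ℓ
      · simp only [hk, if_true]
        rw [lintegral_obsLaw_eq_top P₀ P₁ (hI k)
          (fun x y hxy => obsIndicator_congr f₀ f₁ _ _ _ _ hxy)
          (by exact_mod_cast (Nat.lt_succ_self k).trans hk), obsLaw_top]
      · simp [hk]
    · intro k
      by_cases hk : k + 1 < ℓ
      · simp only [hk, if_true]; exact (hI k).aemeasurable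
      · simp only [hk, if_false]; exact aemeasurable_const
  simp only [hterm]
  rw [ENNReal.tsum_comm, ← ENNReal.tsum_mul_left]
  refine tsum_congr fun k => ?_
  rw [ENNReal.tsum_mul_right, tsum_priorWeight h0 h1 hπ, pow_succ]
  ring

/-- The factor `(1 - ρ)^k` is spread over the `k` transitions, and stopping becomes weight `0`. The
weight inspects only the target of a transition, matching the restriction `k ≥ 1` in `τ`. -/
lemma ANO_eq (hf₀ : Measurable f₀) (hf₁ : Measurable f₁)
    (hpos : ∀ᵐ y ∂P₀, 0 < f₀ y) (h0 : 0 < ρ) (h1 : ρ < 1) {r : ℝ≥0} (hr : oddsBelief r ≤ 1) :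
    ANO P₀ P₁ f₀ f₁ a b ρ (oddsBelief r) =
      ENNReal.ofReal (1 - oddsBelief r) * ((1 - ρ : ℝ≥0) : ℝ≥0∞) *
        discountedObs (fun y => f₁ y / f₀ y) ρ (expOdds b) (expOdds a) P₀ r := by
  rw [ANO_eq_tsum b a P₀ P₁ hf₀ hf₁ h0 h1 hr, discountedObs, potential]
  congr 1
  refine tsum_congr fun k => ?_
  rw [meanTerm, ← lintegral_const_mul _ (measurable_obsIndicator _ _ _ _ hf₀ hf₁ k)]
  refine lintegral_congr_ae ?_
  filter_upwards [ae_forall_eval P₀ hpos] with x hx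
  have hZ : ∀ j, Z f₀ f₁ ρ b (oddsBelief r) x j = logOdds (oddsBelief (chain
      (controlledStep (fun y => f₁ y / f₀ y) ρ (expOdds b)) r x j)) := fun j => by
    rw [Z, belief_eq_oddsBelief h1 b r hx]
  simp only [obsIndicator, hZ, le_logOdds_iff, lt_logOdds_iff, pathTerm, obsReward, stopWeight]
  set R := chain (controlledStep (fun y => f₁ y / f₀ y) ρ (expOdds b)) r x
  by_cases hs : ∀ j < k, R (j + 1) ≤ expOdds a
  · have h2 : ∀ j ≤ k, ¬ (1 ≤ j ∧ expOdds a < R j) := by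
      rintro (_ | j) hj ⟨h3, h4⟩
      · omega
      · exact (hs j hj).not_gt h4
    rw [Finset.prod_congr rfl fun j hj => if_pos (hs j (Finset.mem_range.1 hj)),
      Finset.prod_const, Finset.card_range]
    simp only [and_iff_right h2]
  · push Not at hs
    obtain ⟨j, hj, hlt⟩ := hs
    rw [if_neg fun h2 => h2.1 (j + 1) hj ⟨by omega, hlt⟩, mul_zero,
      Finset.prod_eq_zero (Finset.mem_range.2 hj) (if_neg hlt.not_ge), zero_mul]

end Counts

/-! ### First times, and the climb back to `β` without observations. -/

section FirstTime

lemma firstTime_eq_natCast_iff {Q : ℕ → Prop} {n : ℕ} :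
    firstTime Q = n ↔ Q n ∧ ∀ k < n, ¬ Q k := by
  constructor
  · intro h
    have h1 : ∀ k < n, ¬ Q k := fun k hk =>
      (lt_firstTime_iff.1 (by rw [h]; exact_mod_cast hk)) k le_rfl
    refine ⟨?_, h1⟩
    by_contra hn
    have : (n : ℕ∞) < firstTime Q := lt_firstTime_iff.2 fun k hk => by
      rcases hk.lt_or_eq with h2 | rfl
      exacts [h1 k h2, hn]
    exact this.ne' h
  · rintro ⟨h1, h2⟩
    refine le_antisymm (iInf₂_le n h1) (le_iInf₂ fun k hk => ?_)
    by_contra! h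
    exact h2 k (by exact_mod_cast h) hk

lemma measurable_firstTime {X : Type*} [MeasurableSpace X] {Q : X → ℕ → Prop}
    (hQ : ∀ k, MeasurableSet {x | Q x k}) : Measurable fun x => firstTime (Q x) := by
  refine ENat.measurable_iff.2 fun n => ?_
  have heq : (fun x => firstTime (Q x)) ⁻¹' {(n : ℕ∞)} =
      {x | Q x n} ∩ ⋂ k ∈ Finset.range n, {x | Q x k}ᶜ := by
    ext x
    simp [firstTime_eq_natCast_iff]
  rw [heq]
  exact (hQ n).inter (Finset.measurableSet_biInter _ fun k _ => (hQ k).compl)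

end FirstTime

section Climb

lemma iterate_skipUpdate {ρ : ℝ≥0} (hρ : ρ < 1) (r : ℝ≥0) (k : ℕ) :
    (skipUpdate ρ)^[k] (oddsBelief r) = oddsBelief ((skipOdds ρ)^[k] r) := by
  induction k with
  | zero => rfl
  | succ k ih => rw [Function.iterate_succ_apply', Function.iterate_succ_apply', ih,
      skipUpdate_oddsBelief hρ]

lemma pow_mul_one_add_iterate {ρ : ℝ≥0} (hρ : ρ < 1) (r : ℝ≥0) (k : ℕ) :
    (1 - ρ) ^ k * (1 + (skipOdds ρ)^[k] r) = 1 + r := by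
  induction k with
  | zero => simp
  | succ k ih => rw [Function.iterate_succ_apply', pow_succ, mul_assoc,
      one_sub_mul_one_add_skipOdds hρ, ih]

/-- Since `(1 - ρ)^k (1 + r_k)` is constant along the climb, crossing `β` pins `(1 - ρ)^N` down up
to one factor `1 - ρ`, the effect of integer time. -/
lemma exists_climbTime {ρ : ℝ≥0} (h0 : 0 < ρ) (h1 : ρ < 1) (b : ℝ) {r : ℝ≥0}
    (hr : r ≤ expOdds b) :
    ∃ N : ℕ, climbTime ρ (oddsBelief r) b = N ∧
      (1 - ρ) * ((1 + r) / (1 + expOdds b)) ≤ (1 - ρ) ^ N ∧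
      (1 - ρ) ^ N ≤ (1 + r) / (1 + expOdds b) := by
  classical
  have hpos : 0 < 1 - ρ := tsub_pos_of_lt h1
  have hex : ∃ k, expOdds b < (skipOdds ρ)^[k] r := by
    obtain ⟨k, hk⟩ := exists_pow_lt_of_lt_one (show 0 < (1 + r) / (1 + expOdds b) by positivity)
      (tsub_lt_self one_pos h0 : 1 - ρ < 1)
    refine ⟨k, ?_⟩
    by_contra! h
    rw [lt_div_iff₀ (by positivity)] at hk
    refine hk.not_ge ?_
    rw [← pow_mul_one_add_iterate h1 r k]
    gcongr
  obtain ⟨M, hM⟩ : ∃ M, Nat.find hex = M + 1 := by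
    refine Nat.exists_eq_succ_of_ne_zero fun h => ?_
    have := Nat.find_spec hex
    rw [h] at this
    exact (this.trans_le hr).false
  have hM1 : expOdds b < (skipOdds ρ)^[M + 1] r := hM ▸ Nat.find_spec hex
  have hM2 : ∀ k < M + 1, ¬ expOdds b < (skipOdds ρ)^[k] r := fun k hk =>
    Nat.find_min hex (hM ▸ hk)
  refine ⟨M + 1, ?_, ?_, ?_⟩
  · rw [climbTime, firstTime_eq_natCast_iff]
    simp only [iterate_skipUpdate h1, lt_logOdds_iff]
    exact ⟨hM1, hM2⟩
  · rw [pow_succ']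
    gcongr
    rw [div_le_iff₀ (by positivity), ← pow_mul_one_add_iterate h1 r M]
    gcongr
    exact not_lt.1 (hM2 M (Nat.lt_succ_self M))
  · rw [le_div_iff₀ (by positivity), ← pow_mul_one_add_iterate h1 r (M + 1)]
    gcongr

end Climb

/-! ### The probability of a change within a cycle. -/

section ChangeLaw

lemma changeLaw_apply (ρ π₀ : ℝ) (s : Set ℕ) [DecidablePred (· ∈ s)] :
    changeLaw ρ π₀ s = ∑' k : ℕ, if k ∈ s then ENNReal.ofReal (priorWeight ρ π₀ k) else 0 := by
  rw [changeLaw, Measure.sum_apply _ (.of_discrete)]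
  refine tsum_congr fun k => ?_
  rw [Measure.smul_apply, Measure.dirac_apply, smul_eq_mul, Set.indicator_apply]
  split_ifs <;> simp

lemma changeLaw_lt {ρ : ℝ≥0} (h0 : 0 < ρ) (h1 : ρ < 1) (m : ℕ) :
    changeLaw ρ 0 {k | m < k} = ((1 - ρ : ℝ≥0) : ℝ≥0∞) ^ m := by
  classical
  rw [changeLaw_apply]
  have := tsum_priorWeight h0 h1 zero_le_one m
  rw [sub_zero, ENNReal.ofReal_one, one_mul] at this
  exact this

lemma changeLaw_univ {ρ : ℝ≥0} (h0 : 0 < ρ) (h1 : ρ < 1) : changeLaw ρ 0 Set.univ = 1 := by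
  classical
  have h := changeLaw_lt h0 h1 0
  rw [changeLaw_apply, pow_zero] at h
  rw [changeLaw_apply, ← h]
  refine tsum_congr fun k => ?_
  rcases k with _ | k <;> simp [priorWeight]

lemma changeLaw_le {ρ : ℝ≥0} (h0 : 0 < ρ) (h1 : ρ < 1) (m : ℕ) :
    changeLaw ρ 0 {k | (k : ℕ∞) ≤ (m : ℕ∞)} = 1 - ((1 - ρ : ℝ≥0) : ℝ≥0∞) ^ m := by
  have : IsProbabilityMeasure (changeLaw ρ 0) := ⟨changeLaw_univ h0 h1⟩
  rw [← changeLaw_lt h0 h1 m, ← prob_compl_eq_one_sub .of_discrete]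
  congr 1
  ext k
  simp

variable {E : Type*} {f₀ f₁ : E → ℝ≥0}

/-- For a fixed path the probability is `1 - (1 - ρ)^(n + N)`. The drop time `n` is eventually
constant, so its discount tends to `1`; the climb time `N` grows, and its discount tends to the exit
reward. -/
lemma tendsto_changeLaw_cycleLength {b : ℝ} {x : ℕ → E} (hx : ∀ n, 0 < f₀ (x (n + 1))) {n : ℕ}
    (hn : FirstBelow (expOdds b) (chain (obsStep (fun y => f₁ y / f₀ y) 0) (expOdds b) x) n) :
    Tendsto (fun ρ : ℝ≥0 => changeLaw ρ 0 {k | (k : ℕ∞) ≤ cycleLength f₀ f₁ ρ b x}) (𝓝[>] 0)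
      (𝓝 (1 - exitReward (expOdds b)
        (chain (obsStep (fun y => f₁ y / f₀ y) 0) (expOdds b) x n))) := by
  set L : E → ℝ≥0 := fun y => f₁ y / f₀ y with hL
  set β := expOdds b with hβ
  have hpair : Tendsto (fun ρ : ℝ≥0 => (ρ, β)) (𝓝 0) (𝓝 0 ×ˢ 𝓝[≥] β) :=
    tendsto_id.prodMk (tendsto_const_nhdsWithin (Set.self_mem_Ici (a := β)))
  have hfirst : ∀ᶠ ρ in 𝓝[>] (0 : ℝ≥0), FirstBelow β (chain (obsStep L ρ) β x) n :=
    nhdsWithin_le_nhds (hpair.eventually (eventually_firstBelow hn))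
  have hlt : ∀ᶠ ρ in 𝓝[>] (0 : ℝ≥0), ρ < 1 := nhdsWithin_le_nhds (gt_mem_nhds one_pos)
  have hpos : ∀ᶠ ρ in 𝓝[>] (0 : ℝ≥0), 0 < ρ := self_mem_nhdsWithin
  have hkey : ∀ᶠ ρ : ℝ≥0 in 𝓝[>] (0 : ℝ≥0), ∃ N : ℕ,
      changeLaw ρ 0 {k | (k : ℕ∞) ≤ cycleLength f₀ f₁ ρ b x} =
        1 - ((1 - ρ : ℝ≥0) : ℝ≥0∞) ^ (n + N) ∧
      (1 - ρ) * ((1 + chain (obsStep L ρ) β x n) / (1 + β)) ≤ (1 - ρ) ^ N ∧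
      (1 - ρ) ^ N ≤ (1 + chain (obsStep L ρ) β x n) / (1 + β) := by
    filter_upwards [hfirst, hlt, hpos] with ρ h1 h2 h3
    obtain ⟨N, hN1, hN2⟩ := exists_climbTime h3 h2 b h1.2.le
    refine ⟨N, ?_, hN2⟩
    have hb : belief f₀ f₁ ρ b (beliefOf b) x n = oddsBelief (chain (obsStep L ρ) β x n) := by
      rw [beliefOf_eq, belief_eq_oddsBelief h2 b _ hx, controlled_eq_obs h1.1]
    rw [cycleLength, hatLambda_eq_of_firstBelow b h2 hx h1, ENat.toNat_natCast, hb, hN1,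
      ← Nat.cast_add, changeLaw_le h3 h2]
  have hd : Tendsto (fun ρ : ℝ≥0 => 1 - ρ) (𝓝[>] 0) (𝓝 1) := by
    have : Tendsto (fun ρ : ℝ≥0 => 1 - ρ) (𝓝 0) (𝓝 (1 - 0)) :=
      (continuous_const.sub continuous_id).tendsto 0
    rw [tsub_zero] at this
    exact this.mono_left nhdsWithin_le_nhds
  have hchain : Tendsto (fun ρ : ℝ≥0 => (1 + chain (obsStep L ρ) β x n) / (1 + β)) (𝓝[>] 0)
      (𝓝 ((1 + chain (obsStep L 0) β x n) / (1 + β))) := by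
    have h0 := (continuousAt_chain_obsStep (L := L) (β := β) x n).tendsto.comp
      ((tendsto_id (x := 𝓝 (0 : ℝ≥0))).prodMk_nhds (tendsto_const_nhds (x := β)))
    simp only [Function.comp_def, id] at h0
    exact ((h0.mono_left nhdsWithin_le_nhds).const_add 1).div_const _
  choose! N hN using fun (ρ : ℝ≥0) (h : ∃ N : ℕ,
      changeLaw ρ 0 {k | (k : ℕ∞) ≤ cycleLength f₀ f₁ ρ b x} =
        1 - ((1 - ρ : ℝ≥0) : ℝ≥0∞) ^ (n + N) ∧
      (1 - ρ) * ((1 + chain (obsStep L ρ) β x n) / (1 + β)) ≤ (1 - ρ) ^ N ∧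
      (1 - ρ) ^ N ≤ (1 + chain (obsStep L ρ) β x n) / (1 + β)) => h
  have hlow := hd.mul hchain
  rw [one_mul] at hlow
  have hpowN : Tendsto (fun ρ : ℝ≥0 => (1 - ρ) ^ N ρ) (𝓝[>] 0)
      (𝓝 ((1 + chain (obsStep L 0) β x n) / (1 + β))) :=
    tendsto_of_tendsto_of_tendsto_of_le_of_le' hlow hchain
      (hkey.mono fun ρ h => (hN ρ h).2.1) (hkey.mono fun ρ h => (hN ρ h).2.2)
  have hpow : Tendsto (fun ρ : ℝ≥0 => (1 - ρ) ^ (n + N ρ)) (𝓝[>] 0)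
      (𝓝 ((1 + chain (obsStep L 0) β x n) / (1 + β))) := by
    have := (hd.pow n).mul hpowN
    simpa only [one_pow, one_mul, ← pow_add] using this
  rw [exitReward, if_neg hn.2.not_ge]
  have hsub := ENNReal.Tendsto.sub (tendsto_const_nhds (x := (1 : ℝ≥0∞)))
    (ENNReal.tendsto_coe.2 hpow) (Or.inl ENNReal.one_ne_top)
  refine hsub.congr' ?_
  filter_upwards [hkey] with ρ h
  rw [(hN ρ h).1, ENNReal.coe_pow]

end ChangeLaw

/-! ### Averaging the cycle probability over the observations. -/

section CycleLength

variable {E : Type*} [MeasurableSpace E] {f₀ f₁ : E → ℝ≥0}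

lemma measurable_hatLambda (hf₀ : Measurable f₀) (hf₁ : Measurable f₁) (ρ b : ℝ) :
    Measurable (hatLambda f₀ f₁ ρ b) :=
  measurable_firstTime fun k => (MeasurableSet.const _).inter
    (measurableSet_lt (measurable_Z hf₀ hf₁ ρ b _ k) measurable_const)

lemma measurable_climbTime (ρ b : ℝ) : Measurable fun p => climbTime ρ p b := by
  have hs : Measurable (skipUpdate ρ) := by unfold skipUpdate; fun_prop
  exact measurable_firstTime fun k =>
    measurableSet_lt measurable_const (measurable_logOdds.comp (hs.iterate k))

lemma measurable_cycleLength (hf₀ : Measurable f₀) (hf₁ : Measurable f₁) (ρ b : ℝ) :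
    Measurable (cycleLength f₀ f₁ ρ b) := by
  have h1 := measurable_hatLambda hf₀ hf₁ ρ b
  have h2 : Measurable fun z : ℕ × (ℕ → E) => belief f₀ f₁ ρ b (beliefOf b) z.2 z.1 :=
    measurable_from_prod_countable_right fun k => measurable_belief hf₀ hf₁ ρ b _ k
  have h3 : Measurable fun x => (hatLambda f₀ f₁ ρ b x).toNat :=
    (measurable_of_countable ENat.toNat).comp h1
  have h4 := (measurable_climbTime ρ b).comp (h2.comp (h3.prodMk measurable_id))
  exact (measurable_of_countable fun z : ℕ∞ × ℕ∞ => z.1 + z.2).comp (h1.prodMk h4)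

variable (P₀ P₁ : Measure E) [IsProbabilityMeasure P₀]

lemma probChangeInCycle_eq (hf₀ : Measurable f₀) (hf₁ : Measurable f₁) {ρ : ℝ≥0} (h0 : 0 < ρ)
    (h1 : ρ < 1) (b : ℝ) :
    probChangeInCycle P₀ P₁ f₀ f₁ b ρ =
      ∫⁻ x, changeLaw ρ 0 {k | (k : ℕ∞) ≤ cycleLength f₀ f₁ ρ b x}
        ∂(Measure.infinitePi fun _ : ℕ => P₀) := by
  have : IsProbabilityMeasure (changeLaw ρ 0) := ⟨changeLaw_univ h0 h1⟩
  have hT : MeasurableSet {z : ℕ × ℕ∞ | (z.1 : ℕ∞) ≤ z.2} := (Set.to_countable _).measurableSet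
  have hS : MeasurableSet {ω : ℕ × (ℕ → E) | (ω.1 : ℕ∞) ≤ cycleLength f₀ f₁ ρ b ω.2} :=
    hT.preimage (measurable_fst.prodMk
      ((measurable_cycleLength hf₀ hf₁ ρ b).comp measurable_snd))
  rw [probChangeInCycle, obsLaw_top, Measure.prod_apply_symm hS]
  rfl

lemma one_sub_meanExit_eq {L : E → ℝ≥0} {ρ β : ℝ≥0} (hL : Measurable L)
    (hfin : meanSojourn L ρ β P₀ β < ∞) :
    1 - meanExit P₀ L ρ β β = ∫⁻ x, (1 - ∑' k, pathTerm (obsStep L ρ) (exitReward β)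
      (sojournWeight β) β x k) ∂(Measure.infinitePi fun _ : ℕ => P₀) := by
  have hm : Measurable fun x : ℕ → E =>
      ∑' k, pathTerm (obsStep L ρ) (exitReward β) (sojournWeight β) β x k :=
    Measurable.tsum fun k => (measurable_pathTerm (measurable_obsStep hL) measurable_exitReward
      (measurable_sojournWeight β) k).comp (measurable_const.prodMk measurable_id)
  have hle : ∀ᵐ x ∂(Measure.infinitePi fun _ : ℕ => P₀),
      ∑' k, pathTerm (obsStep L ρ) (exitReward β) (sojournWeight β) β x k ≤ 1 := by
    filter_upwards [ae_exists_firstBelow P₀ hL hfin] with x ⟨n, hn⟩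
    rw [tsum_pathTerm_exit hn]
    exact exitReward_le_one _ _
  rw [lintegral_sub hm _ hle, lintegral_one, measure_univ, meanExit,
    potential_eq_lintegral P₀ (measurable_obsStep hL) measurable_exitReward
      (measurable_sojournWeight β)]
  refine ((lintegral_mono_ae hle).trans_lt ?_).ne
  simp

lemma measurable_changeLaw_cycleLength (hf₀ : Measurable f₀) (hf₁ : Measurable f₁) (ρ b : ℝ) :
    Measurable fun x => changeLaw ρ 0 {k | (k : ℕ∞) ≤ cycleLength f₀ f₁ ρ b x} :=
  (measurable_of_countable fun N : ℕ∞ => changeLaw ρ 0 {k | (k : ℕ∞) ≤ N}).comp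
    (measurable_cycleLength hf₀ hf₁ ρ b)

lemma tendsto_probChangeInCycle (hf₀ : Measurable f₀) (hf₁ : Measurable f₁)
    (hpos : ∀ᵐ y ∂P₀, 0 < f₀ y) {b : ℝ}
    (hfin : meanSojourn (fun y => f₁ y / f₀ y) 0 (expOdds b) P₀ (expOdds b) < ∞) :
    Tendsto (fun ρ : ℝ≥0 => probChangeInCycle P₀ P₁ f₀ f₁ b ρ) (𝓝[>] 0)
      (𝓝 (1 - meanExit P₀ (fun y => f₁ y / f₀ y) 0 (expOdds b) (expOdds b))) := by
  have hev : ∀ᶠ ρ : ℝ≥0 in 𝓝[>] (0 : ℝ≥0), 0 < ρ ∧ ρ < 1 :=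
    (eventually_mem_nhdsWithin (s := Set.Ioi 0)).and (nhdsWithin_le_nhds (gt_mem_nhds one_pos))
  have hL : Measurable fun y => f₁ y / f₀ y := hf₁.div hf₀
  rw [one_sub_meanExit_eq P₀ hL hfin]
  have hmain : Tendsto (fun ρ : ℝ≥0 =>
      ∫⁻ x, changeLaw ρ 0 {k | (k : ℕ∞) ≤ cycleLength f₀ f₁ ρ b x}
        ∂(Measure.infinitePi fun _ : ℕ => P₀)) (𝓝[>] 0)
      (𝓝 (∫⁻ x, (1 - ∑' k, pathTerm (obsStep (fun y => f₁ y / f₀ y) 0) (exitReward (expOdds b))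
      (sojournWeight (expOdds b)) (expOdds b) x k) ∂(Measure.infinitePi fun _ : ℕ => P₀))) := by
    refine tendsto_lintegral_filter_of_dominated_convergence (fun _ => 1)
      (Eventually.of_forall fun ρ => measurable_changeLaw_cycleLength hf₀ hf₁ ρ b) ?_ (by simp) ?_
    · filter_upwards [hev] with ρ ⟨h0, h1⟩
      refine Eventually.of_forall fun x => ?_
      rw [← changeLaw_univ h0 h1]
      exact measure_mono (Set.subset_univ _)
    · filter_upwards [ae_exists_firstBelow P₀ hL hfin, ae_forall_eval P₀ hpos]
        with x ⟨n, hn⟩ hx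
      have hlim := tendsto_changeLaw_cycleLength hx hn
      rwa [← tsum_pathTerm_exit hn] at hlim
  refine hmain.congr' ?_
  filter_upwards [hev] with ρ ⟨h0, h1⟩
  exact (probChangeInCycle_eq P₀ P₁ hf₀ hf₁ h0 h1 b).symm

end CycleLength

/-! ### Change of parameters and conclusion. -/

lemma ofReal_one_sub_oddsBelief (r : ℝ≥0) :
    ENNReal.ofReal (1 - oddsBelief r) = (((1 + r)⁻¹ : ℝ≥0) : ℝ≥0∞) := by
  have h : 1 - oddsBelief r = (((1 + r)⁻¹ : ℝ≥0) : ℝ) := by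
    have : (1 + (r : ℝ)) ≠ 0 := by positivity
    rw [oddsBelief]
    push_cast
    field_simp
    ring
  rw [h, ENNReal.ofReal_coe_nnreal]

lemma ofReal_one_div_one_add_exp (b : ℝ) :
    ENNReal.ofReal (1 / (1 + Real.exp b)) = (((1 + expOdds b)⁻¹ : ℝ≥0) : ℝ≥0∞) := by
  rw [← coe_expOdds, ← NNReal.coe_one, ← NNReal.coe_add, ← NNReal.coe_div,
    ENNReal.ofReal_coe_nnreal, one_div]

lemma tendsto_expOdds_atTop : Tendsto expOdds atTop atTop :=
  tendsto_real_toNNReal_atTop.comp Real.tendsto_exp_atTop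

lemma tendsto_toNNReal_nhdsGT_zero : Tendsto Real.toNNReal (𝓝[>] 0) (𝓝[>] 0) := by
  refine tendsto_nhdsWithin_iff.2 ⟨?_, ?_⟩
  · have := (continuous_real_toNNReal.tendsto 0).mono_left
      (nhdsWithin_le_nhds (s := Set.Ioi (0 : ℝ)))
    rwa [Real.toNNReal_zero] at this
  · filter_upwards [self_mem_nhdsWithin] with ρ hρ
    exact Real.toNNReal_pos.2 hρ

end QuickestChange

end

theorem mainTheorem7 {E : Type*} [MeasurableSpace E] (μ : Measure E) (f₀ f₁ : E → ℝ≥0)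
    (hf₀ : Measurable f₀) (hf₁ : Measurable f₁)
    (P₀ P₁ : Measure E) [IsProbabilityMeasure P₀] [IsProbabilityMeasure P₁]
    (hP₀ : P₀ = μ.withDensity fun x => (f₀ x : ℝ≥0∞))
    (hP₁ : P₁ = μ.withDensity fun x => (f₁ x : ℝ≥0∞))
    (hne : P₀ ≠ P₁)
    (b π₀ : ℝ) (hπ₀ : 0 ≤ π₀) (hπ₀b : QuickestChange.logOdds π₀ ≤ (b : EReal)) :
    -- a limit `1` of the ratio in `[0, ∞]` entails that both sides are eventually
    -- positive and finite
    Tendsto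
      (fun q : ℝ × ℝ =>
        QuickestChange.ANO P₀ P₁ f₀ f₁ q.1 b q.2 π₀ /
          (QuickestChange.meanHatLambda P₀ P₁ f₀ f₁ b q.2 /
              QuickestChange.probChangeInCycle P₀ P₁ f₀ f₁ b q.2 *
            ENNReal.ofReal (1 / (1 + Real.exp b))))
      (atTop ×ˢ 𝓝[>] (0 : ℝ)) (𝓝 1) := by
  obtain ⟨r, hr, rfl, hr1⟩ := QuickestChange.exists_oddsBelief_eq hπ₀ hπ₀b
  have hpos : ∀ᵐ y ∂P₀, 0 < f₀ y := by rw [hP₀]; exact QuickestChange.ae_pos_withDensity hf₀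
  have hL : Measurable fun y => f₁ y / f₀ y := hf₁.div hf₀
  have haff := QuickestChange.lintegral_sqrt_ratio_lt_one hf₀ hf₁ hP₀ hP₁ hne
  obtain ⟨e, he⟩ := ENNReal.canLift.prf _ (haff.trans ENNReal.one_lt_top).ne
  rw [← he, ENNReal.coe_lt_one_iff] at haff
  have hβ := QuickestChange.expOdds_pos b
  have hfin := QuickestChange.meanSojourn_lt_top (ρ := 0) P₀ hL hβ he.symm (by simpa using haff)
    (QuickestChange.expOdds b)
  obtain ⟨m, hm⟩ := ENNReal.canLift.prf _ hfin.ne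
  have hexit := QuickestChange.meanExit_lt_one P₀ hL hfin
  obtain ⟨H, hH⟩ := ENNReal.canLift.prf _ (hexit.trans ENNReal.one_lt_top).ne
  have hH1 : H < 1 := by rwa [← hH, ENNReal.coe_lt_one_iff] at hexit
  have hm1 : 1 ≤ m := by
    have := QuickestChange.one_le_meanSojourn (L := fun y => f₁ y / f₀ y) (ρ := 0)
      (β := QuickestChange.expOdds b) P₀
    rwa [← hm, ENNReal.one_le_coe_iff] at this
  have h1H : 0 < 1 - H := tsub_pos_of_lt hH1
  set K : ℝ≥0 := m / (1 - H) * (1 + QuickestChange.expOdds b)⁻¹ with hK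
  have hK0 : K ≠ 0 := by positivity
  have hρ : Tendsto (fun q : ℝ × ℝ => q.2.toNNReal) (atTop ×ˢ 𝓝[>] 0) (𝓝[>] 0) :=
    QuickestChange.tendsto_toNNReal_nhdsGT_zero.comp tendsto_snd
  have ha : Tendsto (fun q : ℝ × ℝ => QuickestChange.expOdds q.1) (atTop ×ˢ 𝓝[>] 0) atTop :=
    QuickestChange.tendsto_expOdds_atTop.comp tendsto_fst
  have hcoe : ∀ᶠ q : ℝ × ℝ in atTop ×ˢ 𝓝[>] 0, (q.2.toNNReal : ℝ) = q.2 := by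
    have h : ∀ᶠ x : ℝ in 𝓝[>] 0, (x.toNNReal : ℝ) = x := by
      filter_upwards [self_mem_nhdsWithin] with x hx
      exact Real.coe_toNNReal _ (le_of_lt hx)
    exact h.prod_inr _
  have hlt : ∀ᶠ q : ℝ × ℝ in atTop ×ˢ 𝓝[>] 0, 0 < q.2.toNNReal ∧ q.2.toNNReal < 1 :=
    (hρ.eventually self_mem_nhdsWithin).and
      (hρ.eventually (nhdsWithin_le_nhds (gt_mem_nhds one_pos)))
  have hnum : Tendsto (fun q : ℝ × ℝ =>
      QuickestChange.ANO P₀ P₁ f₀ f₁ q.1 b q.2 (QuickestChange.oddsBelief r))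
      (atTop ×ˢ 𝓝[>] 0) (𝓝 (K : ℝ≥0∞)) := by
    have h1 := (QuickestChange.tendsto_discountedObs P₀ hL hβ he.symm haff hr hm.symm hH.symm
      hH1).comp (ha.prodMk hρ)
    have h2 := QuickestChange.tendsto_coe_one_sub.comp (hρ.mono_right nhdsWithin_le_nhds)
    have h3 := ENNReal.Tendsto.mul (ENNReal.Tendsto.const_mul
      (a := (((1 + r)⁻¹ : ℝ≥0) : ℝ≥0∞)) h2 (Or.inl one_ne_zero)) (Or.inr ENNReal.coe_ne_top) h1
      (Or.inr (by simp))
    -- The prior mass `1 - π₀ = (1 + r)⁻¹` cancels the factor `1 + r`, which is why the limit does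
    -- not depend on `π₀`.
    have hval : (((1 + r)⁻¹ : ℝ≥0) : ℝ≥0∞) * 1 *
        ((m / (1 - H) * ((1 + r) / (1 + QuickestChange.expOdds b)) : ℝ≥0) : ℝ≥0∞) = K := by
      rw [mul_one, ← ENNReal.coe_mul, hK]
      congr 1
      have : (1 + r) ≠ 0 := by positivity
      field_simp
    rw [hval] at h3
    refine h3.congr' ?_
    filter_upwards [hcoe, hlt] with q hq1 hq2
    have h4 := QuickestChange.ANO_eq b q.1 P₀ P₁ hf₀ hf₁ hpos hq2.1 hq2.2 hr1.le
    rw [hq1, QuickestChange.ofReal_one_sub_oddsBelief] at h4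
    rw [h4]
    rfl
  have hden : Tendsto (fun q : ℝ × ℝ => QuickestChange.meanHatLambda P₀ P₁ f₀ f₁ b q.2 /
      QuickestChange.probChangeInCycle P₀ P₁ f₀ f₁ b q.2 *
        ENNReal.ofReal (1 / (1 + Real.exp b))) (atTop ×ˢ 𝓝[>] 0) (𝓝 (K : ℝ≥0∞)) := by
    have h1 := (QuickestChange.tendsto_meanSojourn P₀ hL hβ he.symm haff).comp
      (hρ.mono_right nhdsWithin_le_nhds)
    have h2 := (QuickestChange.tendsto_probChangeInCycle P₀ P₁ hf₀ hf₁ hpos hfin).comp hρ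
    rw [← hm] at h1
    rw [← hH, ← ENNReal.coe_one, ← ENNReal.coe_sub] at h2
    have h3 := ENNReal.Tendsto.mul_const (b := (((1 + QuickestChange.expOdds b)⁻¹ : ℝ≥0) : ℝ≥0∞))
      (ENNReal.Tendsto.div h1 (Or.inr (ENNReal.coe_ne_zero.2 h1H.ne')) h2 (Or.inl ENNReal.coe_ne_top))
      (Or.inr ENNReal.coe_ne_top)
    rw [← ENNReal.coe_div h1H.ne', ← ENNReal.coe_mul, ← hK] at h3
    refine h3.congr' ?_
    filter_upwards [hcoe, hlt] with q hq1 hq2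
    have h4 := QuickestChange.meanHatLambda_eq b P₀ P₁ hf₀ hf₁ hpos hq2.2
    rw [hq1] at h4
    simp only [Function.comp_apply]
    rw [h4, hq1, QuickestChange.ofReal_one_div_one_add_exp]
  have := ENNReal.Tendsto.div hnum (Or.inl (by simpa using hK0)) hden
    (Or.inl ENNReal.coe_ne_top)
  rwa [ENNReal.div_self (by simpa using hK0) ENNReal.coe_ne_top] at this
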